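/- Let $G$ be a diffeological group and let $F$ be a non-empty diffeological space with a smooth left action of $G$. Let $\mathbf{Diffeol}_{\mathrm{HSP}}$ be the category of diffeological spaces whose D-topology is Hausdorff and second-countable and which are smoothly paracompact (the D-topology is paracompact, and every D-open cover has a subordinate smooth partition of unity), with all smooth maps as morphisms. Let $EG$ be the Milnor join $\bigstar_{i\in\mathbb N}G$: the quotient of the space of pairs of sequences $(t_i,g_i)_{i\in\mathbb N}$ with $t_i\in[0,1]$, $g_i\in G$, only finitely many $t_i\neq 0$ and $\sum_i t_i=1$, by the relation that identifies $(t_i,g_i)$ with $(t_i',g_i')$ when $t_i=t_i'$ for all $i$ and $g_i=g_i'$ whenever $t_i\ne0$. Let $G$ act on $EG$ by $h\cdot(t_ig_i)=(t_ig_ih^{-1})$ and let $BG=EG/G$, with the product, subset and quotient diffeologies. Let $[X,BG]$ be the set of smooth homotopy classes of smooth maps $X\to BG$, a contravariant functor of $X$ by precomposition. Let $\mathcal B^F_G(X)$ be the set of isomorphism classes (diffeomorphisms of total spaces over $X$) of locally trivial diffeological fibre bundles over $X$ with fibre $F$ and structure group $G$, that is, of smooth surjections $\pi\colon E\to X$ that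 admit local trivialisations $\varphi_i\colon E|_{U_i}\to U_i\times F$ over a D-open cover $\{U_i\}$ of $X$ with $\varphi_i\varphi_j^{-1}(x,y)=(x,g_{ij}(x)\cdot y)$ for smooth maps $g_{ij}\colon U_i\cap U_j\to G$ satisfying $g_{ij}g_{jk}=g_{ik}$ on $U_i\cap U_j\cap U_k$. It is a contravariant functor of $X$ by pullback. Then there is a natural transformation $\eta\colon[\cdot,BG]\to\mathcal B^F_G(\cdot)$ of functors on $\mathbf{Diffeol}_{\mathrm{HSP}}$ such that $\eta_X$ is surjective for every $X$ and such that, for every smooth $f\colon X\to BG$, $\eta_X([f])$ is the class of the associated bundle $f^*EG\times_GF\to X$, where $f^*EG\times_GF$ is the quotient of $f^*EG\times F$ by the diagonal action of $G$. -/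

import Mathlib

open CategoryTheory

universe u

namespace MilnorDiffeology

open Diffeology Topology

noncomputable section

/-! ### Subset, product and quotient diffeologies -/

section Constructions

variable {X Y Z : Type*}

/-- The pullback of a diffeology along a map: `p` is a plot iff `f ∘ p` is one. -/
@[reducible]
def inducedDiffeology (f : X → Y) [DiffeologicalSpace Y] : DiffeologicalSpace X where
  plots n := {p | IsPlot (f ∘ p)}
  constant_plots x := isPlot_const (x := f x)
  plot_reparam hp hf := isPlot_reparam (X := Y) hp hf
  locality h := DiffeologicalSpace.locality (X := Y) fun x => by
    obtain ⟨v, hv, hxv, H⟩ := h x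
    exact ⟨v, hv, hxv, fun hf hf' => H hf hf'⟩

/-- The subset diffeology. -/
instance instSubtype [DiffeologicalSpace X] (s : X → Prop) :
    DiffeologicalSpace {x // s x} :=
  inducedDiffeology Subtype.val

/-- The product diffeology of two spaces. -/
instance instProd [DiffeologicalSpace X] [DiffeologicalSpace Y] :
    DiffeologicalSpace (X × Y) :=
  inducedDiffeology Prod.fst ⊓ inducedDiffeology Prod.snd

/-- The product diffeology of a family. -/
instance instPi {ι : Type*} {A : ι → Type*} [∀ i, DiffeologicalSpace (A i)] :
    DiffeologicalSpace (∀ i, A i) :=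
  ⨅ i, inducedDiffeology fun x : ∀ i, A i => x i

theorem isPlot_of_locally {n : ℕ} {Y : Type*} [DiffeologicalSpace Y]
    {p : EuclideanSpace ℝ (Fin n) → Y}
    (h : ∀ x, ∃ q : EuclideanSpace ℝ (Fin n) → Y, IsPlot q ∧ p =ᶠ[𝓝 x] q) : IsPlot p := by
  refine DiffeologicalSpace.locality fun x => ?_
  obtain ⟨q, hq, hpq⟩ := h x
  obtain ⟨v, hv, hvo, hxv⟩ := eventually_nhds_iff.1 hpq
  refine ⟨v, hvo, hxv, fun {m f} hf hf' => ?_⟩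
  have : p ∘ f = q ∘ f := funext fun y => hv _ (hf y)
  rw [this]
  exact isPlot_reparam hq hf'

/-- The quotient diffeology: the plots are the maps that lift locally to plots upstairs. (A lift
on a neighbourhood of a point agrees, on a smaller neighbourhood, with a plot defined on the whole
Euclidean space.) -/
instance instQuotient [DiffeologicalSpace X] (s : Setoid X) :
    DiffeologicalSpace (Quotient s) where
  plots n := {p | ∀ x, ∃ q : EuclideanSpace ℝ (Fin n) → X,
    IsPlot q ∧ p =ᶠ[𝓝 x] fun y => Quotient.mk s (q y)}
  constant_plots c _ := by
    obtain ⟨a, rfl⟩ := Quotient.exists_rep c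
    exact ⟨fun _ => a, isPlot_const, Filter.Eventually.of_forall fun _ => rfl⟩
  plot_reparam {n m p f} hp hf x := by
    obtain ⟨q, hq, hpq⟩ := hp (f x)
    exact ⟨q ∘ f, isPlot_reparam hq hf, hf.continuous.continuousAt.eventually hpq⟩
  locality {n p} h x := by
    obtain ⟨v, hv, hxv, H⟩ := h x
    obtain ⟨ε, hε, hεv⟩ := Metric.isOpen_iff.1 hv x hxv
    let b : ContDiffBump x := ⟨ε / 2, ε, by positivity, by linarith⟩
    let r : EuclideanSpace ℝ (Fin n) → EuclideanSpace ℝ (Fin n) := fun y => x + b y • (y - x)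
    have hr : ContDiff ℝ (⊤ : ℕ∞) r :=
      contDiff_const.add (b.contDiff.smul (contDiff_id.sub contDiff_const))
    have hrv : ∀ y, r y ∈ v := by
      intro y
      apply hεv
      by_cases hy : y ∈ Metric.ball x ε
      · have h1 : ‖b y • (y - x)‖ ≤ ‖y - x‖ := by
          rw [norm_smul, Real.norm_of_nonneg b.nonneg]
          exact mul_le_of_le_one_left (norm_nonneg _) b.le_one
        rw [mem_ball_iff_norm] at hy ⊢
        simpa [r] using h1.trans_lt hy
      · have : b y = 0 := b.zero_of_le_dist (by simpa using hy)
        simpa [r, this] using hε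
    obtain ⟨q, hq, hpq⟩ := H hrv hr x
    refine ⟨q, hq, ?_⟩
    have hrx : r =ᶠ[𝓝 x] id := by
      filter_upwards [b.eventuallyEq_one] with y hy
      simp [r, hy]
    filter_upwards [hpq, hrx] with y hy hy'
    rw [← hy]
    simp [hy']

variable [DiffeologicalSpace X] [DiffeologicalSpace Y] [DiffeologicalSpace Z]

theorem isPlot_prod_iff {n : ℕ} {p : EuclideanSpace ℝ (Fin n) → X × Y} :
    IsPlot p ↔ IsPlot (fun x => (p x).1) ∧ IsPlot fun x => (p x).2 :=
  DiffeologicalSpace.isPlot_inf_iff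

theorem dsmooth_val {s : X → Prop} : DSmooth (Subtype.val : {x // s x} → X) :=
  fun _ _ hp => hp

theorem dsmooth_subtype {s : X → Prop} {f : Z → {x // s x}}
    (h : DSmooth fun z => (f z).1) : DSmooth f :=
  fun n p hp => h n p hp

theorem dsmooth_fst : DSmooth (Prod.fst : X × Y → X) :=
  fun _ _ hp => (isPlot_prod_iff.1 hp).1

theorem dsmooth_snd : DSmooth (Prod.snd : X × Y → Y) :=
  fun _ _ hp => (isPlot_prod_iff.1 hp).2

theorem dsmooth_prod {f : Z → X} {g : Z → Y} (hf : DSmooth f) (hg : DSmooth g) :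
    DSmooth fun z => (f z, g z) :=
  fun n p hp => isPlot_prod_iff.2 ⟨hf n p hp, hg n p hp⟩

end Constructions

/-- A diffeomorphism of diffeological spaces. -/
structure Diffeo (X Y : Type*) [DiffeologicalSpace X] [DiffeologicalSpace Y] extends X ≃ Y where
  dsmooth_toFun : DSmooth toFun
  dsmooth_invFun : DSmooth invFun

/-- A diffeological group. -/
class DiffeologicalGroup (G : Type*) [Group G] [DiffeologicalSpace G] : Prop where
  dsmooth_mul : DSmooth fun p : G × G => p.1 * p.2
  dsmooth_inv : DSmooth fun g : G => g⁻¹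

/-- A diffeological (that is, smooth) action of `G` on `X`. -/
class DiffeologicalAction (G X : Type*) [Group G] [DiffeologicalSpace G] [DiffeologicalSpace X]
    [MulAction G X] : Prop where
  dsmooth_smul : DSmooth fun p : G × X => p.1 • p.2

/-! ### The category of Hausdorff, second-countable, smoothly paracompact spaces -/

/-- The D-topology is paracompact, and every D-open cover has a subordinate smooth partition of
unity. -/
structure SmoothlyParacompact (X : Type u) [DiffeologicalSpace X] : Prop where
  paracompact : @ParacompactSpace X dTopology
  exists_partition : ∀ (ι : Type u) (U : ι → Set X), (∀ i, IsOpen[dTopology] (U i)) →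
    ⋃ i, U i = Set.univ →
    ∃ ζ : ι → X → ℝ,
      (∀ i, DSmooth (ζ i)) ∧
      (∀ i x, 0 ≤ ζ i x) ∧
      (∀ i, @closure X dTopology (Function.support (ζ i)) ⊆ U i) ∧
      @LocallyFinite ι X dTopology (fun i => Function.support (ζ i)) ∧
      ∀ x, ∑ᶠ i, ζ i x = 1

/-- A Hausdorff, second-countable, smoothly paracompact diffeological space, all three with respect
to the D-topology. -/
structure DiffeolHSP where
  carrier : Type u
  [diffeology : DiffeologicalSpace carrier]
  t2 : @T2Space carrier dTopology
  secondCountable : @SecondCountableTopology carrier dTopology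
  smoothlyParacompact : SmoothlyParacompact carrier

attribute [instance] DiffeolHSP.diffeology

/-- Morphisms are all the smooth maps. -/
instance : Category DiffeolHSP.{u} where
  Hom X Y := {f : X.carrier → Y.carrier // DSmooth f}
  id X := ⟨id, dSmooth_id⟩
  comp f g := ⟨g.1 ∘ f.1, g.2.comp f.2⟩

/-! ### Smooth homotopy classes -/

/-- Two smooth maps are smoothly homotopic if a smooth map `X × ℝ → Y` restricts to them at times
`0` and `1`. -/
def SmoothlyHomotopic {X Y : Type*} [DiffeologicalSpace X] [DiffeologicalSpace Y]
    (f g : {f : X → Y // DSmooth f}) : Prop :=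
  ∃ H : X × ℝ → Y, DSmooth H ∧ (∀ x, H (x, 0) = f.1 x) ∧ ∀ x, H (x, 1) = g.1 x

/-- The set `[X, Y]` of smooth homotopy classes of smooth maps. (Smooth homotopy is an equivalence
relation.) -/
def HomotopyClasses (X Y : Type*) [DiffeologicalSpace X] [DiffeologicalSpace Y] :=
  Quot (SmoothlyHomotopic (X := X) (Y := Y))

/-- The class of a smooth map. -/
def HomotopyClasses.mk {X Y : Type*} [DiffeologicalSpace X] [DiffeologicalSpace Y]
    (f : X → Y) (hf : DSmooth f) : HomotopyClasses X Y :=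
  Quot.mk _ ⟨f, hf⟩

/-- Precomposition `[Y, B] → [X, B]` with a smooth map `X → Y`. -/
def HomotopyClasses.precomp {X Y : Type*} (B : Type*) [DiffeologicalSpace X]
    [DiffeologicalSpace Y] [DiffeologicalSpace B] (φ : X → Y) (hφ : DSmooth φ) :
    HomotopyClasses Y B → HomotopyClasses X B :=
  Quot.map (fun f => ⟨f.1 ∘ φ, f.2.comp hφ⟩) fun _ _ ⟨H, hH, h0, h1⟩ =>
    ⟨fun p => H (φ p.1, p.2), hH.comp (dsmooth_prod (hφ.comp dsmooth_fst) dsmooth_snd),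
      fun x => h0 (φ x), fun x => h1 (φ x)⟩

/-- The contravariant functor `[·, B]`. -/
def homotopyFunctor (B : Type u) [DiffeologicalSpace B] : DiffeolHSP.{u}ᵒᵖ ⥤ Type u where
  obj X := HomotopyClasses X.unop.carrier B
  map φ := TypeCat.ofHom (HomotopyClasses.precomp B φ.unop.1 φ.unop.2)
  map_id X := by
    ext c
    induction c using Quot.ind
    rfl
  map_comp φ ψ := by
    ext c
    induction c using Quot.ind
    rfl

/-! ### The Milnor construction -/

/-- The space of pairs of sequences `(tᵢ), (xᵢ)` with `tᵢ ∈ [0, 1]`, almost all of them zero, and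
`∑ tᵢ = 1`, with the subset diffeology of the product. -/
def PreJoin (A : ℕ → Type u) : Type u :=
  {p : (ℕ → Set.Icc (0 : ℝ) 1) × (∀ i, A i) //
    {i | (p.1 i : ℝ) ≠ 0}.Finite ∧ ∑ᶠ i, (p.1 i : ℝ) = 1}

instance (A : ℕ → Type u) [∀ i, DiffeologicalSpace (A i)] : DiffeologicalSpace (PreJoin A) :=
  inferInstanceAs (DiffeologicalSpace {p : (ℕ → Set.Icc (0 : ℝ) 1) × (∀ i, A i) //
    {i | (p.1 i : ℝ) ≠ 0}.Finite ∧ ∑ᶠ i, (p.1 i : ℝ) = 1})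

/-- `(tᵢ, xᵢ) ∼ (tᵢ', xᵢ')` iff `tᵢ = tᵢ'` for all `i`, and `xᵢ = xᵢ'` whenever `tᵢ ≠ 0`. -/
def joinSetoid (A : ℕ → Type u) : Setoid (PreJoin A) where
  r p q := p.1.1 = q.1.1 ∧ ∀ i, (p.1.1 i : ℝ) ≠ 0 → p.1.2 i = q.1.2 i
  iseqv :=
    { refl := fun _ => ⟨rfl, fun _ _ => rfl⟩
      symm := fun h => ⟨h.1.symm, fun i hi => (h.2 i (by rw [h.1]; exact hi)).symm⟩
      trans := fun h k => ⟨h.1.trans k.1, fun i hi =>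
        (h.2 i hi).trans (k.2 i (by rw [← h.1]; exact hi))⟩ }

/-- The join of a sequence of diffeological spaces. -/
def Join (A : ℕ → Type u) : Type u := Quotient (joinSetoid A)

instance (A : ℕ → Type u) [∀ i, DiffeologicalSpace (A i)] : DiffeologicalSpace (Join A) :=
  inferInstanceAs (DiffeologicalSpace (Quotient (joinSetoid A)))

section Milnor

variable (G : Type u) [Group G]

/-- The total space `EG`, the join of countably many copies of `G`. -/
def EG (G : Type u) : Type u := Join fun _ : ℕ => G

instance [DiffeologicalSpace G] : DiffeologicalSpace (EG G) :=
  inferInstanceAs (DiffeologicalSpace (Join fun _ : ℕ => G))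

/-- The action `h • (tᵢ gᵢ) = (tᵢ gᵢ h⁻¹)` of `G` on `EG`. -/
instance : MulAction G (EG G) where
  smul h := Quotient.map (fun p => ⟨(p.1.1, fun i => p.1.2 i * h⁻¹), p.2⟩) fun _ _ hpq =>
    ⟨hpq.1, fun i hi => congrArg (· * h⁻¹) (hpq.2 i hi)⟩
  one_smul c := by
    induction c using Quotient.inductionOn with
    | h p => exact Quotient.sound ⟨rfl, fun i _ => by simp⟩
  mul_smul g h c := by
    induction c using Quotient.inductionOn with
    | h p => exact Quotient.sound ⟨rfl, fun i _ => by simp [mul_assoc]⟩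

/-- The classifying space `BG = EG / G`. -/
def BG : Type u := Quotient (MulAction.orbitRel G (EG G))

instance [DiffeologicalSpace G] : DiffeologicalSpace (BG G) :=
  inferInstanceAs (DiffeologicalSpace (Quotient (MulAction.orbitRel G (EG G))))

/-- The quotient map `EG → BG`. -/
def EG.proj (z : EG G) : BG G := Quotient.mk (MulAction.orbitRel G (EG G)) z

end Milnor

/-! ### Pullbacks and associated bundles -/

/-- The pullback `f^*E = {(y, e) | f y = π e}` with the subset diffeology of the product. -/
def Pullback {X Y E : Type*} (f : Y → X) (π : E → X) := {p : Y × E // f p.1 = π p.2}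

instance {X Y E : Type*} [DiffeologicalSpace Y] [DiffeologicalSpace E] (f : Y → X) (π : E → X) :
    DiffeologicalSpace (Pullback f π) :=
  inferInstanceAs (DiffeologicalSpace {p : Y × E // f p.1 = π p.2})

/-- The projection `f^*E → Y`. -/
def Pullback.proj {X Y E : Type*} (f : Y → X) (π : E → X) (p : Pullback f π) : Y := p.1.1

section Associated

variable (G : Type u) [Group G] {X : Type u}

/-- The total space of the principal bundle `f^*EG` over `X`, for `f : X → BG`. -/
abbrev PullbackEG (f : X → BG G) : Type u := Pullback f (EG.proj G)

/-- The action of `G` on `f^*EG`, trivial on the base. -/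
instance (f : X → BG G) : MulAction G (PullbackEG G f) where
  smul g p := ⟨(p.1.1, g • p.1.2), p.2.trans
    (Quotient.sound (s := MulAction.orbitRel G (EG G)) ⟨g⁻¹, inv_smul_smul g p.1.2⟩)⟩
  one_smul p := Subtype.ext (Prod.ext rfl (one_smul G p.1.2))
  mul_smul g h p := Subtype.ext (Prod.ext rfl (mul_smul g h p.1.2))

/-- The quotient `P ×_G F` of `P × F` by the diagonal action of `G`. -/
def AssociatedSpace (P F : Type u) [MulAction G P] [MulAction G F] : Type u :=
  Quotient (MulAction.orbitRel G (P × F))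

instance (P F : Type u) [MulAction G P] [MulAction G F] [DiffeologicalSpace P]
    [DiffeologicalSpace F] : DiffeologicalSpace (AssociatedSpace G P F) :=
  inferInstanceAs (DiffeologicalSpace (Quotient (MulAction.orbitRel G (P × F))))

/-- The projection `f^*EG ×_G F → X` of the bundle with fibre `F` associated to `f^*EG`. -/
def associatedProj (F : Type u) [MulAction G F] (f : X → BG G) :
    AssociatedSpace G (PullbackEG G f) F → X :=
  Quotient.lift (fun q => Pullback.proj f (EG.proj G) q.1) <| by
    rintro _ b ⟨g, rfl⟩
    rfl

end Associated

/-! ### Fibre bundles with structure group `G` and fibre `F` -/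

section Bundles

/-- A locally trivial `G`-structure on `π : E → X` with fibre the `G`-space `F`: a local
trivialisation over a D-open cover, together with smooth transition functions
`U i ∩ U j → G` that satisfy the cocycle condition. The values of `trans i j` outside
`U i ∩ U j` are irrelevant. -/
structure GAtlas (G F : Type u) [Group G] [DiffeologicalSpace G] [DiffeologicalSpace F]
    [MulAction G F] {X E : Type u} [DiffeologicalSpace X] [DiffeologicalSpace E]
    (π : E → X) where
  ι : Type u
  U : ι → Set X
  isOpen : ∀ i, IsOpen[dTopology] (U i)
  cover : ⋃ i, U i = Set.univ
  triv : ∀ i, Diffeo {e : E // π e ∈ U i} ({x : X // x ∈ U i} × F)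
  triv_fst : ∀ i e, ((triv i).toFun e).1.1 = π e.1
  trans : ι → ι → X → G
  dsmooth_trans : ∀ i j, DSmooth fun x : {x : X // x ∈ U i ∩ U j} => trans i j x.1
  triv_trans : ∀ i j (e : E) (hi : π e ∈ U i) (hj : π e ∈ U j),
    ((triv i).toFun ⟨e, hi⟩).2 = trans i j (π e) • ((triv j).toFun ⟨e, hj⟩).2
  cocycle : ∀ i j k, ∀ x ∈ U i ∩ U j ∩ U k, trans i j x * trans j k x = trans i k x

/-- A locally trivial diffeological fibre bundle over `X` with fibre the `G`-space `F` and
structure group `G`. (Local triviality over a D-open cover implies local triviality of the pullback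
along every plot.) -/
structure FibreBundle (G F : Type u) [Group G] [DiffeologicalSpace G] [DiffeologicalSpace F]
    [MulAction G F] (X : Type u) [DiffeologicalSpace X] where
  E : Type u
  [diffeology : DiffeologicalSpace E]
  proj : E → X
  dsmooth_proj : DSmooth proj
  surjective_proj : Function.Surjective proj
  locallyTrivial : Nonempty (GAtlas G F proj)

attribute [instance] FibreBundle.diffeology

/-- `π : E → X` and `π' : E' → X` are isomorphic: there is a diffeomorphism `E → E'` over `X`. -/
def BundleIso {X E E' : Type*} [DiffeologicalSpace E] [DiffeologicalSpace E'] (π : E → X)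
    (π' : E' → X) : Prop :=
  ∃ Φ : Diffeo E E', ∀ e, π' (Φ.toFun e) = π e

variable (G F : Type u) [Group G] [DiffeologicalSpace G] [DiffeologicalSpace F] [MulAction G F]

/-- Isomorphism of bundles over `X`. -/
instance bundleSetoid (X : Type u) [DiffeologicalSpace X] : Setoid (FibreBundle G F X) where
  r A B := BundleIso A.proj B.proj
  iseqv :=
    { refl := fun _ => ⟨⟨Equiv.refl _, dSmooth_id, dSmooth_id⟩, fun _ => rfl⟩
      symm := fun ⟨Φ, h⟩ => ⟨⟨Φ.toEquiv.symm, Φ.dsmooth_invFun, Φ.dsmooth_toFun⟩, fun e => by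
        rw [← h]; exact congrArg _ (Φ.apply_symm_apply e)⟩
      trans := fun ⟨Φ, h⟩ ⟨Ψ, k⟩ => ⟨⟨Φ.toEquiv.trans Ψ.toEquiv,
        Ψ.dsmooth_toFun.comp Φ.dsmooth_toFun, Φ.dsmooth_invFun.comp Ψ.dsmooth_invFun⟩,
        fun e => (k _).trans (h e)⟩ }

/-- The set of isomorphism classes of bundles over `X`. -/
def BundleClasses (X : Type u) [DiffeologicalSpace X] : Type (u + 1) :=
  Quotient (bundleSetoid G F X)

variable {G F} {X Y : Type u} [DiffeologicalSpace X] [DiffeologicalSpace Y]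

/-- The pullback of a `G`-structure. -/
def GAtlas.pullback {E : Type u} [DiffeologicalSpace E] {π : E → X} (A : GAtlas G F π)
    (φ : Y → X) (hφ : DSmooth φ) : GAtlas G F (Pullback.proj φ π) where
  ι := A.ι
  U i := φ ⁻¹' A.U i
  isOpen i := (continuous_def.1 hφ.continuous) _ (A.isOpen i)
  cover := by rw [← Set.preimage_iUnion, A.cover, Set.preimage_univ]
  triv i :=
    { toFun := fun p => (⟨p.1.1.1, p.2⟩,
        ((A.triv i).toFun ⟨p.1.1.2, by rw [← p.1.2]; exact p.2⟩).2)
      invFun := fun q => ⟨⟨(q.1.1, ((A.triv i).invFun (⟨φ q.1.1, q.1.2⟩, q.2)).1), by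
        rw [← A.triv_fst]
        exact congrArg (fun z => z.1.1) ((A.triv i).right_inv (⟨φ q.1.1, q.1.2⟩, q.2)).symm⟩,
        q.1.2⟩
      left_inv := by
        rintro ⟨⟨⟨y, e⟩, h⟩, hy⟩
        apply Subtype.ext
        apply Subtype.ext
        refine Prod.ext rfl ?_
        have he : π e ∈ A.U i := by rw [← h]; exact hy
        have : ((⟨φ y, hy⟩, ((A.triv i).toFun ⟨e, he⟩).2) : {x : X // x ∈ A.U i} × F) =
            (A.triv i).toFun ⟨e, he⟩ :=
          Prod.ext (Subtype.ext (h.trans (A.triv_fst i ⟨e, he⟩).symm)) rfl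
        change ((A.triv i).invFun (⟨φ y, hy⟩, ((A.triv i).toFun ⟨e, he⟩).2)).1 = e
        rw [this, (A.triv i).left_inv]
      right_inv := by
        rintro ⟨⟨y, hy⟩, a⟩
        refine Prod.ext rfl ?_
        change ((A.triv i).toFun ((A.triv i).invFun (⟨φ y, hy⟩, a))).2 = a
        exact congrArg Prod.snd ((A.triv i).right_inv (⟨φ y, hy⟩, a))
      dsmooth_toFun := by
        have h0 : DSmooth fun p : {p : Pullback φ π // Pullback.proj φ π p ∈ φ ⁻¹' A.U i} =>
            p.1.1 := dsmooth_val.comp (X := {p : Pullback φ π // _}) (Y := Pullback φ π) dsmooth_val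
        refine dsmooth_prod (dsmooth_subtype (dsmooth_fst.comp h0)) (dsmooth_snd.comp
          ((A.triv i).dsmooth_toFun.comp (dsmooth_subtype (dsmooth_snd.comp h0))))
      dsmooth_invFun := by
        have h1 : DSmooth fun q : {y : Y // y ∈ φ ⁻¹' A.U i} × F => q.1.1 :=
          dsmooth_val.comp dsmooth_fst
        refine dsmooth_subtype (dsmooth_subtype (X := Y × E) (dsmooth_prod h1 ?_))
        exact dsmooth_val.comp ((A.triv i).dsmooth_invFun.comp
          (dsmooth_prod (dsmooth_subtype (hφ.comp h1)) dsmooth_snd)) }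
  triv_fst _ _ := rfl
  trans i j y := A.trans i j (φ y)
  dsmooth_trans i j := (A.dsmooth_trans i j).comp
    (f := fun y : {y : Y // y ∈ φ ⁻¹' A.U i ∩ φ ⁻¹' A.U j} =>
      (⟨φ y.1, y.2⟩ : {x : X // x ∈ A.U i ∩ A.U j}))
    (dsmooth_subtype (hφ.comp dsmooth_val))
  triv_trans i j p hi hj := by
    have hp : φ (Pullback.proj φ π p) = π p.1.2 := p.2
    rw [hp]
    exact A.triv_trans i j p.1.2 _ _
  cocycle i j k y hy := A.cocycle i j k (φ y) hy

/-- The pullback of a bundle. -/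
def FibreBundle.pullback (A : FibreBundle G F X) (φ : Y → X) (hφ : DSmooth φ) :
    FibreBundle G F Y where
  E := Pullback φ A.proj
  proj := Pullback.proj φ A.proj
  dsmooth_proj := dsmooth_fst.comp dsmooth_val
  surjective_proj y := by
    obtain ⟨e, he⟩ := A.surjective_proj (φ y)
    exact ⟨⟨(y, e), he.symm⟩, rfl⟩
  locallyTrivial := A.locallyTrivial.map fun a => a.pullback φ hφ

/-- Pullback of isomorphism classes. -/
def BundleClasses.pullback (φ : Y → X) (hφ : DSmooth φ) :
    BundleClasses G F X → BundleClasses G F Y :=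
  Quotient.map (fun A => A.pullback φ hφ) fun A B ⟨Φ, h⟩ =>
    ⟨{ toFun := fun p => ⟨(p.1.1, Φ.toFun p.1.2), p.2.trans (h _).symm⟩
       invFun := fun p => ⟨(p.1.1, Φ.invFun p.1.2), by
        refine p.2.trans ?_
        rw [← h]
        exact congrArg B.proj (Φ.right_inv p.1.2).symm⟩
       left_inv := fun p => Subtype.ext (Prod.ext rfl (Φ.left_inv _))
       right_inv := fun p => Subtype.ext (Prod.ext rfl (Φ.right_inv _))
       dsmooth_toFun := dsmooth_subtype (X := Y × B.E) (dsmooth_prod (dsmooth_fst.comp dsmooth_val)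
        (Φ.dsmooth_toFun.comp (dsmooth_snd.comp dsmooth_val)))
       dsmooth_invFun := dsmooth_subtype (X := Y × A.E) (dsmooth_prod
        (dsmooth_fst.comp dsmooth_val)
        (Φ.dsmooth_invFun.comp (dsmooth_snd.comp dsmooth_val))) }, fun _ => rfl⟩

variable (G F)

/-- The contravariant functor that sends `X` to the set of isomorphism classes of locally trivial
bundles over `X` with structure group `G` and fibre `F`, and a smooth map to the pullback. -/
def bundleFunctor : DiffeolHSP.{u}ᵒᵖ ⥤ Type (u + 1) where
  obj X := BundleClasses G F X.unop.carrier
  map φ := TypeCat.ofHom (BundleClasses.pullback φ.unop.1 φ.unop.2)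
  map_id X := by
    ext c
    induction c using Quotient.inductionOn with
    | h A =>
      refine Quotient.sound (s := bundleSetoid G F X.unop.carrier) ⟨?_, ?_⟩
      · exact
          { toFun := fun p => p.1.2
            invFun := fun e => ⟨(A.proj e, e), rfl⟩
            left_inv := fun p => Subtype.ext (Prod.ext p.2.symm rfl)
            right_inv := fun _ => rfl
            dsmooth_toFun := dsmooth_snd.comp dsmooth_val
            dsmooth_invFun := dsmooth_subtype (X := X.unop.carrier × A.E)
              (dsmooth_prod A.dsmooth_proj dSmooth_id) }
      · exact fun p => p.2.symm
  map_comp {X Y Z} φ ψ := by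
    ext c
    induction c using Quotient.inductionOn with
    | h A =>
      refine Quotient.sound (s := bundleSetoid G F Z.unop.carrier) ⟨?_, ?_⟩
      · exact
          { toFun := fun p => ⟨(p.1.1, ⟨(ψ.unop.1 p.1.1, p.1.2), p.2⟩), rfl⟩
            invFun := fun p => ⟨(p.1.1, p.1.2.1.2),
              (congrArg φ.unop.1 p.2).trans p.1.2.2⟩
            left_inv := fun _ => rfl
            right_inv := fun p => Subtype.ext (Prod.ext rfl (Subtype.ext (Prod.ext p.2 rfl)))
            dsmooth_toFun := by
              have h1 : DSmooth fun p : Pullback (φ ≫ ψ).unop.1 A.proj => p.1.1 :=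
                dsmooth_fst.comp dsmooth_val
              have h2 : DSmooth fun p : Pullback (φ ≫ ψ).unop.1 A.proj => p.1.2 :=
                dsmooth_snd.comp dsmooth_val
              exact dsmooth_subtype (X := Z.unop.carrier × Pullback φ.unop.1 A.proj)
                (dsmooth_prod h1 (dsmooth_subtype (X := Y.unop.carrier × A.E)
                  (dsmooth_prod (ψ.unop.2.comp h1) h2)))
            dsmooth_invFun := by
              have h0 : DSmooth fun p : Pullback ψ.unop.1 (A.pullback φ.unop.1 φ.unop.2).proj =>
                  p.1 := dsmooth_val
              have h1 : DSmooth fun p : Pullback φ.unop.1 A.proj => p.1.2 :=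
                dsmooth_snd.comp dsmooth_val
              exact dsmooth_subtype (X := Z.unop.carrier × A.E) (dsmooth_prod
                (dsmooth_fst.comp h0) (h1.comp (dsmooth_snd.comp h0))) }
      · exact fun _ => rfl

end Bundles

end

end MilnorDiffeology

open MilnorDiffeology

namespace MilnorDiffeology

open Diffeology Topology ContDiff

noncomputable section

/-! ### Plots -/

section Plots

variable {X Y Z : Type*} [DiffeologicalSpace X] [DiffeologicalSpace Y] [DiffeologicalSpace Z]
  {n : ℕ}

/-! The projection `EG → BG` is a principal bundle. Over the D-open set where the `i`-th weight is
nonzero, the representative with `i`-th coordinate `1` is a smooth section (`BG.isPlot_sec`), and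
two points of one fibre differ by a smoothly varying element of `G` (`EG.isPlot_diff`). Hence the
bundle associated to `f^*EG` has transition functions `coord i z * (coord j z)⁻¹`, for any `z` over
`f x`.

All isomorphisms come from one principle: smooth `G`-valued functions intertwining the cocycles of
two atlases glue to a diffeomorphism over the base (`GAtlas.Comparison.bundleIso`).

Homotopy invariance makes `η` well defined. A homotopy `H` lifts to `EG`, up to time `1`, over small
open sets of the base (`exists_isLift`). Let `ψ N` be the partial sums of a countable partition of
unity subordinate to these sets. The maps `x ↦ H (x, ψ N x)` lead from `f₀` to `f₁`, and two
consecutive ones differ only over a set with a lift, which carries one fibre to the next. The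
infinite composite is locally finite and yields a smooth equivariant map `f₀^*EG → f₁^*EG`
(`exists_isTransport`), hence a comparison of cocycles.

Surjectivity is Milnor's construction. For a cocycle `g` and a countable partition of unity with `ζ
k` supported in `U (r k)`, the point with weights `ζ k x` and coordinates `g (r k) j x` moves within
its orbit when `j` changes. It therefore defines a smooth map to `BG`, whose pullback has the
cocycle `g (r k) (r l)` (`AssociatedBundle.exists_bundleIso`).

Plots have whole Euclidean spaces as domains, so restriction to an open set is expressed throughout
by precomposition with smooth maps into that set. -/

theorem isPlot_of_local {p : EuclideanSpace ℝ (Fin n) → X}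
    (h : ∀ x, ∃ v : Set (EuclideanSpace ℝ (Fin n)), IsOpen v ∧ x ∈ v ∧
      ∀ (m : ℕ) (f : EuclideanSpace ℝ (Fin m) → EuclideanSpace ℝ (Fin n)), ContDiff ℝ ∞ f →
        (∀ y, f y ∈ v) → IsPlot fun y => p (f y)) : IsPlot p :=
  DiffeologicalSpace.locality fun x => by
    obtain ⟨v, hv, hxv, H⟩ := h x
    exact ⟨v, hv, hxv, fun hf hf' => H _ _ hf' hf⟩

/-- Locality with respect to a D-open cover of the space in which a plot takes its values. -/
theorem isPlot_of_cover {ι : Type*} {p : EuclideanSpace ℝ (Fin n) → X} (hp : IsPlot p)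
    (U : ι → Set X) (hU : ∀ i, IsOpen[dTopology] (U i)) (hcov : ∀ y, ∃ i, p y ∈ U i)
    {q : EuclideanSpace ℝ (Fin n) → Y}
    (h : ∀ i (m : ℕ) (f : EuclideanSpace ℝ (Fin m) → EuclideanSpace ℝ (Fin n)), ContDiff ℝ ∞ f →
        (∀ y, p (f y) ∈ U i) → IsPlot fun y => q (f y)) : IsPlot q := by
  refine isPlot_of_local fun x => ?_
  obtain ⟨i, hi⟩ := hcov x
  exact ⟨p ⁻¹' U i, isOpen_iff_preimages_plots.1 (hU i) n p hp, hi, fun m f hf hfv => h i m f hf hfv⟩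

theorem isPlot_quotient_mk {s : Setoid X} {q : EuclideanSpace ℝ (Fin n) → X} (hq : IsPlot q) :
    IsPlot fun y => Quotient.mk s (q y) :=
  fun _ => ⟨q, hq, Filter.Eventually.of_forall fun _ => rfl⟩

/-- To test smoothness, a plot of a quotient may be assumed to lift. -/
theorem isPlot_of_quotient {s : Setoid X} {p : EuclideanSpace ℝ (Fin n) → Quotient s}
    (hp : IsPlot p) {q : EuclideanSpace ℝ (Fin n) → Y}
    (h : ∀ (m : ℕ) (f : EuclideanSpace ℝ (Fin m) → EuclideanSpace ℝ (Fin n))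
      (r : EuclideanSpace ℝ (Fin m) → X), ContDiff ℝ ∞ f → IsPlot r →
      (∀ y, p (f y) = Quotient.mk s (r y)) → IsPlot fun y => q (f y)) : IsPlot q := by
  refine isPlot_of_local fun x => ?_
  obtain ⟨r, hr, hpr⟩ := hp x
  obtain ⟨v, hv, hvo, hxv⟩ := eventually_nhds_iff.1 hpr
  exact ⟨v, hvo, hxv, fun m f hf hfv => h m f (r ∘ f) hf (isPlot_reparam hr hf)
    fun y => hv _ (hfv y)⟩

theorem isPlot_pi_iff {ι : Type*} {A : ι → Type*} [∀ i, DiffeologicalSpace (A i)]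
    {p : EuclideanSpace ℝ (Fin n) → ∀ i, A i} : IsPlot p ↔ ∀ i, IsPlot fun y => p y i :=
  DiffeologicalSpace.isPlot_iInf_iff

theorem dsmooth_restrict_iff {s : X → Prop} {f : X → Y} :
    DSmooth (fun x : {x // s x} => f x.1) ↔
      ∀ (n : ℕ) (p : EuclideanSpace ℝ (Fin n) → X), IsPlot p → (∀ y, s (p y)) →
        IsPlot fun y => f (p y) :=
  ⟨fun h n p hp hs => h n (fun y => ⟨p y, hs y⟩) hp, fun h n p hp => h n _ hp fun y => (p y).2⟩

theorem isPlot_real_of_contDiff {p : EuclideanSpace ℝ (Fin n) → ℝ} {f : ℝ → ℝ}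
    (hf : ContDiff ℝ ∞ f) (hp : IsPlot p) : IsPlot fun y => f (p y) :=
  hf.dSmooth _ _ hp

theorem isOpen_setOf_ne_zero {f : X → ℝ} (hf : DSmooth f) : IsOpen[dTopology] {x | f x ≠ 0} :=
  isOpen_iff_preimages_plots.2 fun _ _ hp =>
    isOpen_ne_fun (hf _ _ hp).contDiff.continuous continuous_const

theorem isOpen_preimage {f : X → Y} (hf : DSmooth f) {U : Set Y} (hU : IsOpen[dTopology] U) :
    IsOpen[dTopology] (f ⁻¹' U) :=
  isOpen_iff_preimages_plots.2 fun n p hp => isOpen_iff_preimages_plots.1 hU n (f ∘ p) (hf n p hp)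

/-- A smooth map `ℝ → ℝ` that is the identity near `m` and stays near `m`. -/
theorem exists_smooth_clamp (m : ℝ) {r R : ℝ} (hr : 0 < r) (hrR : r < R) :
    ∃ κ : ℝ → ℝ, ContDiff ℝ ∞ κ ∧ (∀ s, |κ s - m| < R) ∧ ∀ s, |s - m| ≤ r → κ s = s := by
  -- The displacement `s - m` is damped by a bump function. Composition with the result extends data
  -- given on an interval to smooth data on the whole line.
  let b : ContDiffBump m := ⟨r, R, hr, hrR⟩
  refine ⟨fun s => m + b s * (s - m),
    contDiff_const.add (b.contDiff.mul (contDiff_id.sub contDiff_const)), fun s => ?_, fun s hs => ?_⟩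
  · have hR : 0 < R := hr.trans hrR
    by_cases h : |s - m| < R
    · rw [add_sub_cancel_left, abs_mul, abs_of_nonneg b.nonneg]
      exact (mul_le_of_le_one_left (abs_nonneg _) b.le_one).trans_lt h
    · have : b s = 0 := b.zero_of_le_dist (by simpa [Real.dist_eq] using h)
      simpa [this] using hR
  · have : b s = 1 := b.one_of_mem_closedBall (by simpa [Real.dist_eq] using hs)
    simp [this]

end Plots

section Group

variable {G : Type*} [Group G] [DiffeologicalSpace G] {n : ℕ}
  {p q : EuclideanSpace ℝ (Fin n) → G}

theorem isPlot_smul {F : Type*} [DiffeologicalSpace F] [MulAction G F] [DiffeologicalAction G F]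
    {a : EuclideanSpace ℝ (Fin n) → F} (hp : IsPlot p) (ha : IsPlot a) :
    IsPlot fun y => p y • a y :=
  DiffeologicalAction.dsmooth_smul n _ (isPlot_prod_iff.2 ⟨hp, ha⟩ : IsPlot fun y => (p y, a y))

variable [DiffeologicalGroup G]

theorem isPlot_mul (hp : IsPlot p) (hq : IsPlot q) : IsPlot fun y => p y * q y :=
  DiffeologicalGroup.dsmooth_mul n _ (isPlot_prod_iff.2 ⟨hp, hq⟩ : IsPlot fun y => (p y, q y))

theorem isPlot_inv (hp : IsPlot p) : IsPlot fun y => (p y)⁻¹ :=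
  DiffeologicalGroup.dsmooth_inv n _ hp

end Group

/-! ### Coordinates on the Milnor join -/

namespace EG

section Algebra

variable {G : Type u}

/-- The point of `EG` with weights `t` and coordinates `g`. -/
def mk (t : ℕ → ℝ) (h0 : ∀ i, 0 ≤ t i) (hfin : (Function.support t).Finite)
    (h1 : ∑ᶠ i, t i = 1) (g : ℕ → G) : EG G :=
  Quotient.mk (joinSetoid fun _ => G)
    ⟨(fun i => ⟨t i, h0 i, h1 ▸ single_le_finsum i hfin h0⟩, g), hfin, h1⟩

/-- The weights of a point of `EG`. -/
def weight (i : ℕ) : EG G → ℝ :=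
  Quotient.lift (fun p : PreJoin fun _ => G => (p.1.1 i : ℝ)) fun _ _ h => by
    rw [h.1]

open Classical in
/-- The coordinates of a point of `EG`, with value `1` where the weight vanishes. -/
def coord [One G] (i : ℕ) : EG G → G :=
  Quotient.lift (fun p : PreJoin fun _ => G => if (p.1.1 i : ℝ) ≠ 0 then p.1.2 i else 1)
    fun p q h => by
      by_cases hp : (p.1.1 i : ℝ) ≠ 0
      · rw [if_pos hp, if_pos (by rw [← h.1]; exact hp), h.2 i hp]
      · rw [if_neg hp, if_neg (by rw [← h.1]; exact hp)]

theorem coord_mk [One G] (t : ℕ → ℝ) (h0 hfin h1) (g : ℕ → G) {i : ℕ} (hi : t i ≠ 0) :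
    coord i (mk t h0 hfin h1 g) = g i := if_pos hi

theorem ext_weight_coord [One G] {z w : EG G} (ht : ∀ i, weight i z = weight i w)
    (hg : ∀ i, weight i z ≠ 0 → coord i z = coord i w) : z = w := by
  induction z using Quotient.inductionOn with | h p =>
  induction w using Quotient.inductionOn with | h q =>
  refine Quotient.sound ⟨funext fun i => Subtype.ext (ht i), fun i hi => ?_⟩
  have h := hg i hi
  have hi' : (q.1.1 i : ℝ) ≠ 0 := by rw [← show (p.1.1 i : ℝ) = q.1.1 i from ht i]; exact hi
  change (if (p.1.1 i : ℝ) ≠ 0 then p.1.2 i else 1) = if (q.1.1 i : ℝ) ≠ 0 then q.1.2 i else 1 at h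
  rwa [if_pos hi, if_pos hi'] at h

theorem exists_weight_ne_zero (z : EG G) : ∃ i, weight i z ≠ 0 := by
  induction z using Quotient.inductionOn with | h p =>
  by_contra! h
  have h1 := p.2.2
  rw [finsum_congr (show ∀ i, (p.1.1 i : ℝ) = 0 from h), finsum_zero] at h1
  exact zero_ne_one h1

variable [Group G]

@[simp]
theorem weight_smul (i : ℕ) (h : G) (z : EG G) : weight i (h • z) = weight i z := by
  induction z using Quotient.inductionOn with | h p => rfl

theorem coord_smul {i : ℕ} (h : G) {z : EG G} (hz : weight i z ≠ 0) :
    coord i (h • z) = coord i z * h⁻¹ := by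
  induction z using Quotient.inductionOn with | h p =>
  exact (if_pos hz).trans (congrArg (· * h⁻¹) (if_pos hz).symm)

/-- The action is free: some weight of `z` is nonzero, and the coordinate there is multiplied by
`h⁻¹`. -/
theorem smul_left_injective (z : EG G) : Function.Injective fun h : G => h • z := by
  intro h k hk
  obtain ⟨i, hi⟩ := exists_weight_ne_zero z
  have := congrArg (coord i) hk
  simpa [coord_smul _ hi] using this

theorem proj_smul (h : G) (z : EG G) : proj G (h • z) = proj G z :=
  Quotient.sound (s := MulAction.orbitRel G (EG G)) ⟨h, rfl⟩

theorem exists_smul_eq {z w : EG G} (h : proj G z = proj G w) : ∃ k : G, k • z = w :=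
  Quotient.exact (s := MulAction.orbitRel G (EG G)) h.symm

theorem proj_surjective : Function.Surjective (proj G) := Quotient.exists_rep

open Classical in
/-- The element of `G` that takes `z` to `w`, if they are in the same orbit. -/
def diff (z w : EG G) : G := if h : ∃ k : G, k • z = w then h.choose else 1

theorem diff_smul {z w : EG G} (h : proj G z = proj G w) : diff z w • z = w := by
  rw [diff, dif_pos (exists_smul_eq h)]
  exact (exists_smul_eq h).choose_spec

theorem diff_eq {z w : EG G} {k : G} (h : k • z = w) : diff z w = k :=
  smul_left_injective z ((diff_smul (by rw [← h, proj_smul])).trans h.symm)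

theorem diff_smul_right {z w : EG G} (k : G) (h : proj G z = proj G w) :
    diff z (k • w) = k * diff z w :=
  diff_eq (by rw [mul_smul, diff_smul h])

theorem diff_eq_coord {z w : EG G} (h : proj G z = proj G w) {i : ℕ} (hi : weight i z ≠ 0) :
    diff z w = (coord i w)⁻¹ * coord i z := by
  obtain ⟨k, rfl⟩ := exists_smul_eq h
  rw [diff_eq rfl, coord_smul k hi]
  group

end Algebra

section Smooth

variable {G : Type u} [DiffeologicalSpace G] {n : ℕ}

theorem isPlot_weight {i : ℕ} {p : EuclideanSpace ℝ (Fin n) → EG G} (hp : IsPlot p) :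
    IsPlot fun y => weight i (p y) := by
  refine isPlot_of_quotient (s := joinSetoid fun _ => G) hp fun m f r _ hr h => ?_
  simp only [h]
  exact isPlot_pi_iff.1 (isPlot_prod_iff.1 hr).1 i

theorem dsmooth_weight (i : ℕ) : DSmooth (weight (G := G) i) := fun _ _ hp => isPlot_weight hp

theorem isPlot_mk {t : EuclideanSpace ℝ (Fin n) → ℕ → ℝ} {h0 : ∀ y i, 0 ≤ t y i}
    {hfin : ∀ y, (Function.support (t y)).Finite} {h1 : ∀ y, ∑ᶠ i, t y i = 1}
    {g : EuclideanSpace ℝ (Fin n) → ℕ → G} (ht : ∀ i, IsPlot fun y => t y i)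
    (hg : ∀ i, IsPlot fun y => g y i) :
    IsPlot fun y => mk (t y) (h0 y) (hfin y) (h1 y) (g y) := by
  refine isPlot_quotient_mk (s := joinSetoid fun _ => G) ?_
  exact isPlot_prod_iff.2 ⟨isPlot_pi_iff.2 ht, isPlot_pi_iff.2 hg⟩

/-- The default value `1` may destroy smoothness where the weight vanishes. Elsewhere the coordinate
can be read off from any local lift to `PreJoin`. -/
theorem isPlot_coord [One G] {i : ℕ} {p : EuclideanSpace ℝ (Fin n) → EG G} (hp : IsPlot p)
    (hi : ∀ y, weight i (p y) ≠ 0) : IsPlot fun y => coord i (p y) := by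
  refine isPlot_of_quotient (s := joinSetoid fun _ => G) hp fun m f r _ hr h => ?_
  have : (fun y => coord i (p (f y))) = fun y => (r y).1.2 i := funext fun y => by
    rw [h y]
    exact if_pos (by have := hi (f y); rwa [h y] at this)
  rw [this]
  exact isPlot_pi_iff.1 (isPlot_prod_iff.1 hr).2 i

variable [Group G]

theorem isPlot_proj {p : EuclideanSpace ℝ (Fin n) → EG G} (hp : IsPlot p) :
    IsPlot fun y => proj G (p y) :=
  isPlot_quotient_mk (s := MulAction.orbitRel G (EG G)) hp

variable [DiffeologicalGroup G]

instance : DiffeologicalAction G (EG G) where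
  dsmooth_smul n p hp := by
    obtain ⟨hg, hz⟩ := isPlot_prod_iff.1 hp
    refine isPlot_of_quotient (s := joinSetoid fun _ => G) hz fun m f r hf hr h => ?_
    have hr' := isPlot_prod_iff.1 hr
    have : (fun y => ((fun q : G × EG G => q.1 • q.2) ∘ p) (f y)) = fun y =>
        Quotient.mk (joinSetoid fun _ => G)
          ⟨((r y).1.1, fun i => (r y).1.2 i * ((p (f y)).1)⁻¹), (r y).2⟩ := funext fun y => by
      change (p (f y)).1 • (p (f y)).2 = _
      rw [h y]
      rfl
    rw [this]
    refine isPlot_quotient_mk ?_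
    exact isPlot_prod_iff.2 ⟨hr'.1, isPlot_pi_iff.2 fun i =>
      isPlot_mul (isPlot_pi_iff.1 hr'.2 i) (isPlot_inv (isPlot_reparam hg hf))⟩

/-- The sets where a weight is nonzero form a D-open cover, and on each of them `diff` is a quotient
of coordinates. -/
theorem isPlot_diff {p q : EuclideanSpace ℝ (Fin n) → EG G} (hp : IsPlot p) (hq : IsPlot q)
    (h : ∀ y, proj G (p y) = proj G (q y)) : IsPlot fun y => diff (p y) (q y) := by
  refine isPlot_of_cover hp (fun i => {z | weight i z ≠ 0})
    (fun i => isOpen_setOf_ne_zero (dsmooth_weight i)) (fun y => exists_weight_ne_zero _)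
    fun i m f hf hi => ?_
  have hi' : ∀ y, weight i (q (f y)) ≠ 0 := fun y => by
    obtain ⟨k, hk⟩ := exists_smul_eq (h (f y))
    rw [← hk, weight_smul]
    exact hi y
  have : (fun y => diff (p (f y)) (q (f y))) =
      fun y => (coord i (q (f y)))⁻¹ * coord i (p (f y)) :=
    funext fun y => diff_eq_coord (h (f y)) (hi y)
  rw [this]
  exact isPlot_mul (isPlot_inv (isPlot_coord (isPlot_reparam hq hf) hi'))
    (isPlot_coord (isPlot_reparam hp hf) hi)

end Smooth

end EG

/-! ### Local sections of `EG → BG` -/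

namespace BG

variable {G : Type u} [Group G]

/-- The weights of a point of `BG`. -/
def weight (i : ℕ) : BG G → ℝ :=
  Quotient.lift (s := MulAction.orbitRel G (EG G)) (EG.weight i) <| by
    rintro _ b ⟨g, rfl⟩
    exact EG.weight_smul i g b

theorem weight_proj (i : ℕ) (z : EG G) : weight i (EG.proj G z) = EG.weight i z := rfl

/-- The section of `EG → BG` over the set where the `i`-th weight does not vanish, normalised to
have `i`-th coordinate `1`. -/
def sec (i : ℕ) (b : BG G) : EG G :=
  EG.coord i (Quotient.out (s := MulAction.orbitRel G (EG G)) b) •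
    Quotient.out (s := MulAction.orbitRel G (EG G)) b

theorem proj_sec (i : ℕ) (b : BG G) : EG.proj G (sec i b) = b :=
  (EG.proj_smul _ _).trans (Quotient.out_eq (s := MulAction.orbitRel G (EG G)) b)

theorem exists_weight_ne_zero (b : BG G) : ∃ i, weight i b ≠ 0 := by
  obtain ⟨z, rfl⟩ := EG.proj_surjective b
  exact EG.exists_weight_ne_zero z

theorem weight_sec (i j : ℕ) (b : BG G) : EG.weight i (sec j b) = weight i b := by
  rw [← weight_proj, proj_sec]

theorem coord_sec {i : ℕ} {b : BG G} (h : weight i b ≠ 0) : EG.coord i (sec i b) = 1 := by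
  rw [← weight_sec i i, sec, EG.weight_smul] at h
  rw [sec, EG.coord_smul _ h, mul_inv_cancel]

/-- The action is free, so having `i`-th coordinate `1` singles out one point of the orbit. The
arbitrary representative in `sec` is thus irrelevant, and `sec` can be computed from any smooth
local lift. -/
theorem sec_proj {i : ℕ} {z : EG G} (h : EG.weight i z ≠ 0) :
    sec i (EG.proj G z) = EG.coord i z • z := by
  have h1 := EG.diff_eq_coord (proj_sec i (EG.proj G z)).symm h
  rw [coord_sec (b := EG.proj G z) h, inv_one, one_mul] at h1
  rw [← h1, EG.diff_smul (proj_sec i _).symm]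

variable [DiffeologicalSpace G] {n : ℕ}

theorem dsmooth_weight (i : ℕ) : DSmooth (weight (G := G) i) := by
  intro n p hp
  refine isPlot_of_quotient (s := MulAction.orbitRel G (EG G)) hp fun m f r _ hr h => ?_
  have : (fun y => (weight i ∘ p) (f y)) = fun y => EG.weight i (r y) :=
    funext fun y => congrArg (weight i) (h y)
  rw [this]
  exact EG.isPlot_weight hr

theorem isOpen_weight (i : ℕ) : IsOpen[dTopology] {b : BG G | weight i b ≠ 0} :=
  isOpen_setOf_ne_zero (dsmooth_weight i)

theorem isPlot_sec [DiffeologicalGroup G] {i : ℕ} {p : EuclideanSpace ℝ (Fin n) → BG G}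
    (hp : IsPlot p) (hi : ∀ y, weight i (p y) ≠ 0) : IsPlot fun y => sec i (p y) := by
  refine isPlot_of_quotient (s := MulAction.orbitRel G (EG G)) hp fun m f r _ hr h => ?_
  have hi' : ∀ y, EG.weight i (r y) ≠ 0 := fun y => by
    rw [← weight_proj, EG.proj, ← h y]
    exact hi _
  have : (fun y => sec i (p (f y))) = fun y => EG.coord i (r y) • r y := funext fun y => by
    rw [← sec_proj (hi' y), EG.proj, ← h y]
  rw [this]
  exact isPlot_smul (EG.isPlot_coord hr hi') hr

end BG

/-! ### Bundles with comparable transition functions are isomorphic -/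

namespace GAtlas

variable {G F : Type u} [Group G] [DiffeologicalSpace G] [DiffeologicalSpace F] [MulAction G F]
  {X E E' : Type u} [DiffeologicalSpace X] [DiffeologicalSpace E] [DiffeologicalSpace E']
  {π : E → X} {π' : E' → X}

section

variable (A : GAtlas G F π)

theorem exists_mem (x : X) : ∃ i, x ∈ A.U i := Set.mem_iUnion.1 (A.cover ▸ Set.mem_univ x)

/-- The fibre coordinate of a point in a local trivialisation. -/
def fibre (i : A.ι) (e : E) (h : π e ∈ A.U i) : F := ((A.triv i).toFun ⟨e, h⟩).2

/-- The point with given coordinates in a local trivialisation. -/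
def point (i : A.ι) (x : X) (h : x ∈ A.U i) (a : F) : E := ((A.triv i).invFun (⟨x, h⟩, a)).1

theorem proj_point (i : A.ι) (x : X) (h : x ∈ A.U i) (a : F) : π (A.point i x h a) = x := by
  have h1 := A.triv_fst i ((A.triv i).invFun (⟨x, h⟩, a))
  have h2 : (A.triv i).toFun ((A.triv i).invFun (⟨x, h⟩, a)) = (⟨x, h⟩, a) :=
    (A.triv i).right_inv _
  rw [h2] at h1
  exact h1.symm

theorem fibre_point (i : A.ι) (x : X) (h : x ∈ A.U i) (a : F)
    (h' : π (A.point i x h a) ∈ A.U i) : A.fibre i (A.point i x h a) h' = a :=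
  congrArg Prod.snd ((A.triv i).right_inv (⟨x, h⟩, a))

theorem ext_fibre (i : A.ι) {e e' : E} (h : π e ∈ A.U i) (h' : π e' ∈ A.U i) (hp : π e = π e')
    (hf : A.fibre i e h = A.fibre i e' h') : e = e' := by
  have : (⟨e, h⟩ : {e : E // π e ∈ A.U i}) = ⟨e', h'⟩ :=
    (A.triv i).injective <| Prod.ext (Subtype.ext
      ((A.triv_fst i ⟨e, h⟩).trans (hp.trans (A.triv_fst i ⟨e', h'⟩).symm))) hf
  exact congrArg Subtype.val this

theorem fibre_eq_smul (i j : A.ι) (e : E) (hi : π e ∈ A.U i) (hj : π e ∈ A.U j) :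
    A.fibre i e hi = A.trans i j (π e) • A.fibre j e hj :=
  A.triv_trans i j e hi hj

theorem trans_self {i : A.ι} {x : X} (h : x ∈ A.U i) : A.trans i i x = 1 :=
  mul_eq_left.1 (A.cocycle i i i x ⟨⟨h, h⟩, h⟩)

theorem inv_trans {i j : A.ι} {x : X} (hi : x ∈ A.U i) (hj : x ∈ A.U j) :
    (A.trans i j x)⁻¹ = A.trans j i x :=
  inv_eq_of_mul_eq_one_right ((A.cocycle i j i x ⟨⟨hi, hj⟩, hi⟩).trans (A.trans_self hi))

theorem isPlot_trans (i j : A.ι) {n : ℕ} {p : EuclideanSpace ℝ (Fin n) → X} (hp : IsPlot p)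
    (h : ∀ y, p y ∈ A.U i ∩ A.U j) : IsPlot fun y => A.trans i j (p y) :=
  dsmooth_restrict_iff.1 (A.dsmooth_trans i j) n p hp h

theorem isPlot_fibre (i : A.ι) {n : ℕ} {p : EuclideanSpace ℝ (Fin n) → E} (hp : IsPlot p)
    (h : ∀ y, π (p y) ∈ A.U i) : IsPlot fun y => A.fibre i (p y) (h y) :=
  dsmooth_snd _ _ ((A.triv i).dsmooth_toFun n
    (fun y => (⟨p y, h y⟩ : {e : E // π e ∈ A.U i})) hp)

theorem isPlot_point (i : A.ι) {n : ℕ} {p : EuclideanSpace ℝ (Fin n) → X}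
    {a : EuclideanSpace ℝ (Fin n) → F} (hp : IsPlot p) (h : ∀ y, p y ∈ A.U i) (ha : IsPlot a) :
    IsPlot fun y => A.point i (p y) (h y) (a y) :=
  (A.triv i).dsmooth_invFun n (fun y => ((⟨p y, h y⟩ : {x : X // x ∈ A.U i}), a y))
    (isPlot_prod_iff.2 ⟨hp, ha⟩)

end

/-- Smooth `G`-valued functions that compare the transition functions of two atlases. -/
structure Comparison (A : GAtlas G F π) (B : GAtlas G F π') where
  toFun : A.ι → B.ι → X → G
  isPlot_toFun : ∀ i j (n : ℕ) (p : EuclideanSpace ℝ (Fin n) → X), IsPlot p →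
    (∀ y, p y ∈ A.U i) → (∀ y, p y ∈ B.U j) → IsPlot fun y => toFun i j (p y)
  trans_mul : ∀ i i' j x, x ∈ A.U i → x ∈ A.U i' → x ∈ B.U j →
    A.trans i i' x * toFun i' j x = toFun i j x
  mul_trans : ∀ i j j' x, x ∈ A.U i → x ∈ B.U j → x ∈ B.U j' →
    toFun i j x * B.trans j j' x = toFun i j' x

namespace Comparison

variable {A : GAtlas G F π} {B : GAtlas G F π'}

/-- The inverse comparison. -/
def symm [DiffeologicalGroup G] (c : Comparison A B) : Comparison B A where
  toFun j i x := (c.toFun i j x)⁻¹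
  isPlot_toFun j i n p hp hj hi := isPlot_inv (c.isPlot_toFun i j n p hp hi hj)
  trans_mul j j' i x hj hj' hi := by
    rw [← c.mul_trans i j j' x hi hj hj']
    group
  mul_trans j i i' x hj hi hi' := by
    rw [← c.trans_mul i i' j x hi hi' hj]
    group

theorem symm_symm [DiffeologicalGroup G] (c : Comparison A B) : c.symm.symm = c := by
  cases c
  simp [symm]

/-- The map of total spaces determined by a comparison. -/
def map (c : Comparison A B) (e : E) : E' :=
  B.point (B.exists_mem (π e)).choose (π e) (B.exists_mem (π e)).choose_spec
    ((c.toFun (A.exists_mem (π e)).choose (B.exists_mem (π e)).choose (π e))⁻¹ •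
      A.fibre (A.exists_mem (π e)).choose e (A.exists_mem (π e)).choose_spec)

theorem proj_map (c : Comparison A B) (e : E) : π' (c.map e) = π e := B.proj_point _ _ _ _

/-- `map` uses arbitrarily chosen charts. The two intertwining identities show that the same formula
holds in every pair of charts, which gives smoothness and invertibility. -/
theorem fibre_map (c : Comparison A B) (e : E) (i : A.ι) (j : B.ι) (hi : π e ∈ A.U i)
    (hj : π' (c.map e) ∈ B.U j) :
    B.fibre j (c.map e) hj = (c.toFun i j (π e))⁻¹ • A.fibre i e hi := by
  have hj1 : π e ∈ B.U j := by rwa [c.proj_map] at hj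
  have hi' := (A.exists_mem (π e)).choose_spec
  have hj' := (B.exists_mem (π e)).choose_spec
  have hjj : ∀ k, B.trans j k (π' (c.map e)) = B.trans j k (π e) := fun k => by rw [c.proj_map]
  rw [B.fibre_eq_smul j _ (c.map e) hj (by rw [c.proj_map]; exact hj'), hjj,
    A.fibre_eq_smul i _ e hi hi']
  unfold map
  rw [B.fibre_point, smul_smul, smul_smul, ← c.trans_mul _ _ _ _ hi hi' hj1,
    ← c.mul_trans _ _ _ _ hi' hj' hj1, ← B.inv_trans hj' hj1]
  congr 1
  group

theorem dsmooth_map [DiffeologicalGroup G] [DiffeologicalAction G F] (c : Comparison A B)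
    (hπ : DSmooth π) : DSmooth c.map := by
  intro n p hp
  refine isPlot_of_cover (hπ n p hp) (fun k : A.ι × B.ι => A.U k.1 ∩ B.U k.2)
    (fun k => @IsOpen.inter _ dTopology _ _ (A.isOpen _) (B.isOpen _))
    (fun y => ⟨⟨_, _⟩, (A.exists_mem _).choose_spec, (B.exists_mem _).choose_spec⟩) ?_
  rintro ⟨i, j⟩ m f hf h
  have hpf : IsPlot fun y => p (f y) := isPlot_reparam hp hf
  have hq : IsPlot fun y => π (p (f y)) := isPlot_reparam (hπ n p hp) hf
  have : (fun y => (c.map ∘ p) (f y)) = fun y => B.point j (π (p (f y))) (h y).2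
      ((c.toFun i j (π (p (f y))))⁻¹ • A.fibre i (p (f y)) (h y).1) := funext fun y => by
    have hj : π' (c.map (p (f y))) ∈ B.U j := by rw [c.proj_map]; exact (h y).2
    refine B.ext_fibre j hj (by rw [B.proj_point]; exact (h y).2)
      ((c.proj_map _).trans (B.proj_point _ _ _ _).symm) ?_
    rw [B.fibre_point]
    exact c.fibre_map _ _ _ _ _
  rw [this]
  exact B.isPlot_point j hq _ (isPlot_smul
    (isPlot_inv (c.isPlot_toFun i j _ _ hq (fun y => (h y).1) fun y => (h y).2))
    (A.isPlot_fibre i hpf _))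

theorem map_symm_map [DiffeologicalGroup G] (c : Comparison A B) (e : E) :
    c.symm.map (c.map e) = e := by
  obtain ⟨i, hi⟩ := A.exists_mem (π e)
  obtain ⟨j, hj⟩ := B.exists_mem (π e)
  have hj' : π' (c.map e) ∈ B.U j := by rwa [c.proj_map]
  have hp : π (c.symm.map (c.map e)) = π e := (c.symm.proj_map _).trans (c.proj_map e)
  have hi' : π (c.symm.map (c.map e)) ∈ A.U i := by rwa [hp]
  refine A.ext_fibre i hi' hi hp ?_
  rw [c.symm.fibre_map _ j i hj' hi', c.fibre_map e i j hi hj', c.proj_map, smul_smul]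
  simp [symm]

theorem bundleIso [DiffeologicalGroup G] [DiffeologicalAction G F] (c : Comparison A B)
    (hπ : DSmooth π) (hπ' : DSmooth π') : BundleIso π π' :=
  ⟨{ toFun := c.map
     invFun := c.symm.map
     left_inv := c.map_symm_map
     right_inv := fun e => by simpa only [c.symm_symm] using c.symm.map_symm_map e
     dsmooth_toFun := c.dsmooth_map hπ
     dsmooth_invFun := c.symm.dsmooth_map hπ' }, c.proj_map⟩

end Comparison

end GAtlas

/-! ### The associated bundle -/

namespace AssociatedBundle

variable {G : Type u} [Group G] {F : Type u} [MulAction G F] {X : Type u}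
  {f : X → BG G}

variable (F f) in
/-- The total space of the bundle associated to `f^*EG`. -/
abbrev Total : Type u := AssociatedSpace G (PullbackEG G f) F

variable (f) in
/-- The class of a point of `f^*EG × F`. -/
def mk (x : X) (z : EG G) (h : f x = EG.proj G z) (a : F) : Total F f :=
  Quotient.mk (MulAction.orbitRel G (PullbackEG G f × F)) (⟨(x, z), h⟩, a)

theorem proj_mk (x : X) (z : EG G) (h : f x = EG.proj G z) (a : F) :
    associatedProj G F f (mk f x z h a) = x := rfl

theorem exists_rep (e : Total F f) : ∃ x z h a, mk f x z h a = e := by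
  obtain ⟨⟨⟨⟨x, z⟩, h⟩, a⟩, rfl⟩ := Quotient.exists_rep e
  exact ⟨x, z, h, a, rfl⟩

theorem mk_smul (x : X) (z : EG G) (h : f x = EG.proj G z) (a : F) (k : G) :
    mk f x (k • z) (h.trans (EG.proj_smul k z).symm) (k • a) = mk f x z h a :=
  Quotient.sound (s := MulAction.orbitRel G (PullbackEG G f × F)) ⟨k, rfl⟩

/-- The fibre coordinate over the set where the `i`-th weight does not vanish. -/
def coord (i : ℕ) (e : Total F f) : F :=
  EG.coord i (Quotient.out (s := MulAction.orbitRel G (PullbackEG G f × F)) e).1.1.2 •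
    (Quotient.out (s := MulAction.orbitRel G (PullbackEG G f × F)) e).2

/-- Replacing `(z, a)` by `(k • z, k • a)` multiplies the coordinate of `z` by `k⁻¹` on the right,
which cancels the `k` in front of `a`. -/
theorem coord_mk {i : ℕ} (x : X) (z : EG G) (h : f x = EG.proj G z) (a : F)
    (hz : EG.weight i z ≠ 0) : coord i (mk f x z h a) = EG.coord i z • a := by
  obtain ⟨k, hk⟩ : ∃ k : G, k • ((⟨(x, z), h⟩, a) : PullbackEG G f × F) =
      Quotient.out (s := MulAction.orbitRel G (PullbackEG G f × F)) (mk f x z h a) :=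
    Quotient.exact (s := MulAction.orbitRel G (PullbackEG G f × F)) (Quotient.out_eq _)
  rw [coord, ← hk]
  change EG.coord i (k • z) • k • a = _
  rw [EG.coord_smul k hz, smul_smul, inv_mul_cancel_right]

theorem mk_sec {i : ℕ} (x : X) (z : EG G) (h : f x = EG.proj G z) (a : F)
    (hi : BG.weight i (f x) ≠ 0) :
    mk f x (BG.sec i (f x)) (BG.proj_sec _ _).symm (coord i (mk f x z h a)) = mk f x z h a := by
  have hz : EG.weight i z ≠ 0 := by rwa [h, BG.weight_proj] at hi
  rw [← mk_smul x z h a (EG.coord i z)]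
  congr 1
  · rw [h, BG.sec_proj hz]
  · rw [mk_smul x z h a, coord_mk x z h a hz]

theorem surjective_proj [Nonempty F] : Function.Surjective (associatedProj G F f) := fun x =>
  ⟨mk f x (BG.sec 0 (f x)) (BG.proj_sec _ _).symm (Classical.arbitrary F), rfl⟩

/-- The transition functions of `f^*EG`. -/
def trans (i j : ℕ) (b : BG G) : G := EG.coord i (BG.sec j b)

theorem trans_proj {i j : ℕ} {z : EG G} (hi : EG.weight i z ≠ 0) (hj : EG.weight j z ≠ 0) :
    trans i j (EG.proj G z) = EG.coord i z * (EG.coord j z)⁻¹ := by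
  rw [trans, BG.sec_proj hj, EG.coord_smul _ hi]

variable [DiffeologicalSpace G] [DiffeologicalSpace F] [DiffeologicalSpace X] {n : ℕ}

theorem isPlot_mk {x : EuclideanSpace ℝ (Fin n) → X} {z : EuclideanSpace ℝ (Fin n) → EG G}
    {a : EuclideanSpace ℝ (Fin n) → F} (hx : IsPlot x) (hz : IsPlot z)
    (h : ∀ y, f (x y) = EG.proj G (z y)) (ha : IsPlot a) :
    IsPlot fun y => mk f (x y) (z y) (h y) (a y) := by
  have h1 : IsPlot fun y => (⟨(x y, z y), h y⟩ : PullbackEG G f) :=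
    show IsPlot fun y => (x y, z y) from isPlot_prod_iff.2 ⟨hx, hz⟩
  exact isPlot_quotient_mk (s := MulAction.orbitRel G (PullbackEG G f × F))
    (isPlot_prod_iff.2 ⟨h1, ha⟩)

/-- To test smoothness, a plot of the associated bundle may be assumed to lift. -/
theorem isPlot_of_mk {Y : Type*} [DiffeologicalSpace Y] {p : EuclideanSpace ℝ (Fin n) → Total F f}
    (hp : IsPlot p) {q : EuclideanSpace ℝ (Fin n) → Y}
    (h : ∀ (m : ℕ) (r : EuclideanSpace ℝ (Fin m) → EuclideanSpace ℝ (Fin n))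
      (x : EuclideanSpace ℝ (Fin m) → X) (z : EuclideanSpace ℝ (Fin m) → EG G)
      (hxz : ∀ y, f (x y) = EG.proj G (z y)) (a : EuclideanSpace ℝ (Fin m) → F),
      IsPlot x → IsPlot z → IsPlot a →
      (∀ y, p (r y) = mk f (x y) (z y) (hxz y) (a y)) → IsPlot fun y => q (r y)) : IsPlot q := by
  refine isPlot_of_quotient (s := MulAction.orbitRel G (PullbackEG G f × F)) hp
    fun m r s _ hs hps => ?_
  have h1 : IsPlot fun y => (s y).1 := (isPlot_prod_iff.1 hs).1
  have h2 : IsPlot fun y => ((s y).1.1.1, (s y).1.1.2) := h1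
  exact h m r (fun y => (s y).1.1.1) (fun y => (s y).1.1.2) (fun y => (s y).1.2) (fun y => (s y).2)
    (isPlot_prod_iff.1 h2).1 (isPlot_prod_iff.1 h2).2 (isPlot_prod_iff.1 hs).2 hps

theorem dsmooth_proj : DSmooth (associatedProj G F f) := fun n p hp =>
  isPlot_of_mk hp fun m r x z hxz a hx _ _ hpr => by
    have : (fun y => (associatedProj G F f ∘ p) (r y)) = x := funext fun y =>
      congrArg (associatedProj G F f) (hpr y)
    rwa [this]

theorem isPlot_coord [DiffeologicalAction G F] {i : ℕ}
    {p : EuclideanSpace ℝ (Fin n) → Total F f} (hp : IsPlot p)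
    (h : ∀ y, BG.weight i (f (associatedProj G F f (p y))) ≠ 0) :
    IsPlot fun y => coord i (p y) :=
  isPlot_of_mk hp fun m r x z hxz a _ hz ha hpr => by
    have hw : ∀ y, EG.weight i (z y) ≠ 0 := fun y => by
      have := h (r y)
      rwa [hpr, proj_mk, hxz, BG.weight_proj] at this
    have : (fun y => coord i (p (r y))) = fun y => EG.coord i (z y) • a y := funext fun y => by
      rw [hpr, coord_mk _ _ _ _ (hw y)]
    rw [this]
    exact isPlot_smul (EG.isPlot_coord hz hw) ha

variable (F) in
/-- The local trivialisations of the associated bundle over the sets where one of the weights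
does not vanish. -/
def atlas [DiffeologicalGroup G] [DiffeologicalAction G F] (hf : DSmooth f) :
    GAtlas G F (associatedProj G F f) where
  ι := ULift ℕ
  U i := {x | BG.weight i.down (f x) ≠ 0}
  isOpen i := isOpen_preimage hf (BG.isOpen_weight i.down)
  cover := Set.iUnion_eq_univ_iff.2 fun x => by
    obtain ⟨i, hi⟩ := BG.exists_weight_ne_zero (f x)
    exact ⟨⟨i⟩, hi⟩
  triv i :=
    { toFun := fun e => (⟨associatedProj G F f e.1, e.2⟩, coord i.down e.1)
      invFun := fun q => ⟨mk f q.1.1 (BG.sec i.down (f q.1.1)) (BG.proj_sec _ _).symm q.2, q.1.2⟩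
      left_inv := by
        rintro ⟨e, he⟩
        obtain ⟨x, z, h, a, rfl⟩ := exists_rep e
        exact Subtype.ext (mk_sec x z h a he)
      right_inv := by
        rintro ⟨⟨x, hx⟩, a⟩
        refine Prod.ext rfl ?_
        change coord i.down (mk f x (BG.sec i.down (f x)) _ a) = a
        rw [coord_mk _ _ _ _ (by rw [BG.weight_sec]; exact hx), BG.coord_sec hx, one_smul]
      dsmooth_toFun := by
        intro n p hp
        have hp' : IsPlot fun y => (p y).1 := hp
        exact isPlot_prod_iff.2 ⟨dsmooth_proj n _ hp', isPlot_coord hp' fun y => (p y).2⟩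
      dsmooth_invFun := by
        intro n p hp
        have hx : IsPlot fun y => (p y).1.1 := (isPlot_prod_iff.1 hp).1
        exact isPlot_mk hx (BG.isPlot_sec (hf n _ hx) fun y => (p y).1.2) _
          (isPlot_prod_iff.1 hp).2 }
  triv_fst _ _ := rfl
  trans i j x := trans i.down j.down (f x)
  dsmooth_trans i j := (dsmooth_restrict_iff
    (f := fun x => trans i.down j.down (f x))).2 fun n p hp h =>
    EG.isPlot_coord (BG.isPlot_sec (hf n p hp) fun y => (h y).2) fun y => by
      rw [BG.weight_sec]
      exact (h y).1
  triv_trans i j e hi hj := by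
    obtain ⟨x, z, h, a, rfl⟩ := exists_rep e
    have hz : ∀ i, BG.weight i (f x) ≠ 0 → EG.weight i z ≠ 0 := fun i hi => by
      rwa [h, BG.weight_proj] at hi
    change coord i.down (mk f x z h a) = trans i.down j.down (f x) • coord j.down (mk f x z h a)
    rw [coord_mk _ _ _ _ (hz _ hi), coord_mk _ _ _ _ (hz _ hj), h, trans_proj (hz _ hi) (hz _ hj),
      smul_smul, inv_mul_cancel_right]
  cocycle i j k x hx := by
    obtain ⟨z, hz⟩ := EG.proj_surjective (f x)
    have hz : ∀ i, BG.weight i (f x) ≠ 0 → EG.weight i z ≠ 0 := fun i hi => by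
      rwa [← hz, BG.weight_proj] at hi
    rw [← ‹EG.proj G z = f x›, trans_proj (hz _ hx.1.1) (hz _ hx.1.2),
      trans_proj (hz _ hx.1.2) (hz _ hx.2), trans_proj (hz _ hx.1.1) (hz _ hx.2)]
    group

variable (F) in
/-- The fibre bundle associated to `f^*EG`. -/
def bundle [DiffeologicalGroup G] [DiffeologicalAction G F] [Nonempty F] (hf : DSmooth f) :
    FibreBundle G F X where
  E := Total F f
  proj := associatedProj G F f
  dsmooth_proj := dsmooth_proj
  surjective_proj := surjective_proj
  locallyTrivial := ⟨atlas F hf⟩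

/-- Forming the associated bundle commutes with pullback. -/
theorem bundleIso_pullback [DiffeologicalGroup G] [DiffeologicalAction G F] [Nonempty F]
    (hf : DSmooth f) {Y : Type u} [DiffeologicalSpace Y] {φ : Y → X} (hφ : DSmooth φ) :
    BundleIso (bundle F (hf.comp hφ)).proj ((bundle F hf).pullback φ hφ).proj := by
  -- The two atlases have the same transition functions, so these functions are themselves the
  -- comparison and the cocycle condition is all that is needed.
  have h := (atlas F (hf.comp hφ)).cocycle
  let c : GAtlas.Comparison (atlas F (hf.comp hφ)) ((atlas F hf).pullback φ hφ) :=
    { toFun := (atlas F (hf.comp hφ)).trans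
      isPlot_toFun := fun i j n p hp hi hj =>
        (atlas F (hf.comp hφ)).isPlot_trans i j hp fun y => ⟨hi y, hj y⟩
      trans_mul := fun i i' j x hi hi' hj => h i i' j x ⟨⟨hi, hi'⟩, hj⟩
      mul_trans := fun i j j' x hi hj hj' => h i j j' x ⟨⟨hi, hj⟩, hj'⟩ }
  exact c.bundleIso dsmooth_proj ((bundle F hf).pullback φ hφ).dsmooth_proj

end AssociatedBundle

/-! ### Countable smooth partitions of unity -/

theorem DiffeolHSP.exists_countable_partition (X : DiffeolHSP.{u}) [Nonempty X.carrier]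
    {ι : Type u} (U : ι → Set X.carrier) (hU : ∀ i, IsOpen[dTopology] (U i))
    (hcov : ⋃ i, U i = Set.univ) :
    ∃ (r : ℕ → ι) (ζ : ℕ → X.carrier → ℝ), (∀ k, DSmooth (ζ k)) ∧ (∀ k x, 0 ≤ ζ k x) ∧
      (∀ x, ∑ᶠ k, ζ k x = 1) ∧
      ∀ x, ∃ W, IsOpen[dTopology] W ∧ x ∈ W ∧ ∃ S : Finset ℕ,
        (∀ k ∉ S, ∀ y ∈ W, ζ k y = 0) ∧ ∀ k ∈ S, W ⊆ U (r k) := by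
  let _ : TopologicalSpace X.carrier := dTopology
  have := X.secondCountable
  -- The weights in the join are indexed by `ℕ`, so the cover is first made countable by the
  -- Lindelöf property.
  obtain ⟨T, hT, hTU⟩ := TopologicalSpace.isOpen_iUnion_countable U hU
  rw [hcov] at hTU
  have hTne : T.Nonempty := by
    by_contra h
    rw [Set.not_nonempty_iff_eq_empty] at h
    obtain ⟨x⟩ := ‹Nonempty X.carrier›
    have : x ∈ ⋃ i ∈ T, U i := hTU ▸ Set.mem_univ x
    simp [h] at this
  obtain ⟨r, rfl⟩ := hT.exists_eq_range hTne
  rw [Set.biUnion_range] at hTU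
  obtain ⟨ζ, h1, h2, h3, h4, h5⟩ := X.smoothlyParacompact.exists_partition (ULift.{u} ℕ)
    (fun k => U (r k.down)) (fun k => hU _) (by
      rw [← hTU]
      exact Equiv.ulift.iSup_congr fun _ => rfl)
  have hlf : LocallyFinite fun k : ℕ => closure (Function.support (ζ ⟨k⟩)) :=
    (h4.comp_injective (Equiv.ulift.{u}.symm : ℕ ≃ ULift ℕ).injective).closure
  refine ⟨r, fun k => ζ ⟨k⟩, fun k => h1 _, fun k => h2 _, fun x => ?_, fun x => ?_⟩
  · rw [← h5 x]
    exact finsum_comp_equiv (f := fun k => ζ k x) Equiv.ulift.{u}.symm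
  · have hS := hlf.point_finite x
    obtain ⟨W, hWs, hW, hxW⟩ := mem_nhds_iff.1 (hlf.iInter_compl_mem_nhds
      (fun _ => isClosed_closure) x)
    -- `S` consists of the `k` whose closed support contains `x`. The neighbourhood avoids all other
    -- closed supports and lies in `U (r k)` for each `k ∈ S`.
    refine ⟨W ∩ ⋂ k ∈ hS.toFinset, U (r k), hW.inter (isOpen_biInter_finset fun k _ => hU _),
      ⟨hxW, Set.mem_iInter₂.2 fun k hk => h3 ⟨k⟩ (hS.mem_toFinset.1 hk)⟩, hS.toFinset,
      fun k hk y hy => ?_, fun k hk y hy => Set.mem_iInter₂.1 hy.2 k hk⟩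
    by_contra hne
    have hk' : x ∉ closure (Function.support (ζ ⟨k⟩)) := fun h => hk (hS.mem_toFinset.2 h)
    exact Set.mem_iInter₂.1 (hWs hy.1) k hk' (subset_closure hne)

/-! ### Transport -/

/-- `Φ` is a smooth equivariant map from the pullback of `EG` along `a` to the one along `b`. -/
structure IsTransport {G : Type u} [Group G] [DiffeologicalSpace G] {X : Type*}
    [DiffeologicalSpace X] (a b : X → BG G) (Φ : X → EG G → EG G) : Prop where
  proj : ∀ x z, EG.proj G z = a x → EG.proj G (Φ x z) = b x
  smul : ∀ x z (k : G), EG.proj G z = a x → Φ x (k • z) = k • Φ x z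
  isPlot : ∀ (n : ℕ) (x : EuclideanSpace ℝ (Fin n) → X) (z : EuclideanSpace ℝ (Fin n) → EG G),
    IsPlot x → IsPlot z → (∀ y, EG.proj G (z y) = a (x y)) → IsPlot fun y => Φ (x y) (z y)

/-- `σ` is a smooth map on `V × ℝ` that lifts `H` up to time `b`. -/
structure IsLift {G : Type u} [Group G] [DiffeologicalSpace G] {X : Type*}
    [DiffeologicalSpace X] (H : X × ℝ → BG G) (V : Set X) (b : ℝ) (σ : X → ℝ → EG G) : Prop where
  isPlot : ∀ (n : ℕ) (x : EuclideanSpace ℝ (Fin n) → X) (s : EuclideanSpace ℝ (Fin n) → ℝ),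
    IsPlot x → IsPlot s → (∀ y, x y ∈ V) → IsPlot fun y => σ (x y) (s y)
  proj : ∀ x ∈ V, ∀ s ≤ b, EG.proj G (σ x s) = H (x, s)

theorem BG.sec_eq_smul {G : Type u} [Group G] {i : ℕ} (j : ℕ) {b : BG G}
    (h : BG.weight i b ≠ 0) : BG.sec i b = EG.coord i (BG.sec j b) • BG.sec j b := by
  conv_lhs => rw [← BG.proj_sec j b]
  exact BG.sec_proj (by rwa [BG.weight_sec])

section Transport

variable {G : Type u} [Group G] [DiffeologicalSpace G] {X : Type*} [DiffeologicalSpace X]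

theorem IsTransport.refl (a : X → BG G) : IsTransport a a fun _ z => z :=
  ⟨fun _ _ h => h, fun _ _ _ _ => rfl, fun _ _ _ _ hz _ => hz⟩

theorem IsTransport.trans {a b c : X → BG G} {Φ Ψ : X → EG G → EG G} (hΦ : IsTransport a b Φ)
    (hΨ : IsTransport b c Ψ) : IsTransport a c fun x z => Ψ x (Φ x z) where
  proj x z h := hΨ.proj x _ (hΦ.proj x z h)
  smul x z k h := by rw [hΦ.smul x z k h, hΨ.smul x _ k (hΦ.proj x z h)]
  isPlot n x z hx hz h :=
    hΨ.isPlot n x _ hx (hΦ.isPlot n x z hx hz h) fun y => hΦ.proj _ _ (h y)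

/-- Locally finite infinite composites of transports. -/
theorem IsTransport.exists_limit {a : ℕ → X → BG G} {b : X → BG G} {T : ℕ → X → EG G → EG G}
    (hT : ∀ k, IsTransport (a k) (a (k + 1)) (T k))
    (hb : ∀ x, ∃ W, IsOpen[dTopology] W ∧ x ∈ W ∧ ∃ N, ∀ k ≥ N, ∀ y ∈ W,
      a k y = b y ∧ ∀ z, T k y z = z) :
    ∃ Φ, IsTransport (a 0) b Φ := by
  let Φ : ℕ → X → EG G → EG G := fun k => Nat.rec (fun _ z => z) (fun k φ x z => T k x (φ x z)) k
  have hΦ : ∀ k, IsTransport (a 0) (a k) (Φ k) := fun k => by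
    induction k with
    | zero => exact IsTransport.refl _
    | succ k ih => exact ih.trans (hT k)
  choose W hW hxW N hN using hb
  have hconst : ∀ x y, y ∈ W x → ∀ k ≥ N x, ∀ z, Φ k y z = Φ (N x) y z := fun x y hy k hk z => by
    induction k, hk using Nat.le_induction with
    | base => rfl
    | succ k hk ih => exact ((hN x k hk y hy).2 _).trans ih
  -- The stage `N y` need not be locally constant in `y`. On `W x` it may be replaced by the fixed
  -- stage `N x`, which is smooth.
  have heq : ∀ x y, y ∈ W x → ∀ z, Φ (N y) y z = Φ (N x) y z := fun x y hy z => by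
    rw [← hconst x y hy _ (le_max_left (N x) (N y)), hconst y y (hxW y) _ (le_max_right _ _)]
  refine ⟨fun x z => Φ (N x) x z, fun x z h => ?_, fun x z k h => (hΦ _).smul x z k h,
    fun n x z hx hz h => ?_⟩
  · rw [(hΦ _).proj x z h]
    exact (hN x _ le_rfl x (hxW x)).1
  · refine isPlot_of_cover hx W hW (fun y => ⟨_, hxW _⟩) fun x₀ m f hf hy => ?_
    simp only [heq x₀ _ (hy _)]
    exact (hΦ _).isPlot m _ _ (isPlot_reparam hx hf) (isPlot_reparam hz hf) fun y => h _

variable [DiffeologicalGroup G]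

-- Over `V`, a point `k • σ x (a x)` is carried to `k • σ x (b x)`. Nothing is known of `σ` outside
-- `V`; there `hab` supplies neighbourhoods on which the map is the identity.
open Classical in
theorem IsLift.isTransport {H : X × ℝ → BG G} {V : Set X} {c : ℝ} {σ : X → ℝ → EG G}
    (hσ : IsLift H V c σ) (hV : IsOpen[dTopology] V) {a b : X → ℝ} (ha : DSmooth a)
    (hb : DSmooth b) (hac : ∀ x, a x ≤ c) (hbc : ∀ x, b x ≤ c)
    (hab : ∀ x ∉ V, ∃ W, IsOpen[dTopology] W ∧ x ∈ W ∧ ∀ y ∈ W, a y = b y) :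
    IsTransport (fun x => H (x, a x)) (fun x => H (x, b x)) fun x z =>
      if a x = b x then z else EG.diff (σ x (a x)) z • σ x (b x) := by
  have hmem : ∀ {x}, a x ≠ b x → x ∈ V := fun {x} hne => by
    by_contra hx
    obtain ⟨W, _, hxW, h⟩ := hab x hx
    exact hne (h x hxW)
  refine ⟨fun x z h => ?_, fun x z k h => ?_, fun n x z hx hz h => ?_⟩
  · split_ifs with hx
    · rw [h, hx]
    · rw [EG.proj_smul, hσ.proj x (hmem hx) _ (hbc x)]
  · split_ifs with hx
    · rfl
    · rw [EG.diff_smul_right k ((hσ.proj x (hmem hx) _ (hac x)).trans h.symm), mul_smul]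
  · let U : Option {x // x ∉ V} → Set X := fun o => o.elim V fun x => (hab x.1 x.2).choose
    refine isPlot_of_cover hx U (fun o => ?_) (fun y => ?_) fun o m f hf hy => ?_
    · cases o with
      | none => exact hV
      | some x => exact (hab x.1 x.2).choose_spec.1
    · by_cases hy : x y ∈ V
      · exact ⟨none, hy⟩
      · exact ⟨some ⟨_, hy⟩, (hab _ hy).choose_spec.2.1⟩
    · have hxf : IsPlot fun y => x (f y) := isPlot_reparam hx hf
      have hzf : IsPlot fun y => z (f y) := isPlot_reparam hz hf
      cases o with
      | none =>
        have hyV : ∀ y, x (f y) ∈ V := hy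
        have hp : ∀ y, EG.proj G (σ (x (f y)) (a (x (f y)))) = EG.proj G (z (f y)) := fun y =>
          (hσ.proj _ (hyV y) _ (hac _)).trans (h _).symm
        -- Over `V` the case distinction is superfluous: for equal times the formula returns the
        -- given point.
        have : ∀ y, (if a (x (f y)) = b (x (f y)) then z (f y) else
            EG.diff (σ (x (f y)) (a (x (f y)))) (z (f y)) • σ (x (f y)) (b (x (f y)))) =
            EG.diff (σ (x (f y)) (a (x (f y)))) (z (f y)) • σ (x (f y)) (b (x (f y))) := fun y => by
          split_ifs with he
          · rw [← he, EG.diff_smul (hp y)]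
          · rfl
        simp only [this]
        exact isPlot_smul (EG.isPlot_diff (hσ.isPlot m _ _ hxf (ha _ _ hxf) hyV) hzf hp)
          (hσ.isPlot m _ _ hxf (hb _ _ hxf) hyV)
      | some x₀ =>
        have : ∀ y, a (x (f y)) = b (x (f y)) := fun y => (hab x₀.1 x₀.2).choose_spec.2.2 _ (hy y)
        simp only [this, if_true]
        exact hzf

end Transport

/-! ### Local lifts of homotopies -/

section Lifts

variable {G : Type u} [Group G] [DiffeologicalSpace G] {X : Type*} [DiffeologicalSpace X]

theorem isOpen_setOf_forall_ne_zero {g : X × ℝ → ℝ} (hg : DSmooth g) {K : Set ℝ}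
    (hK : IsCompact K) : IsOpen[dTopology] {x | ∀ s ∈ K, g (x, s) ≠ 0} := by
  refine isOpen_iff_preimages_plots.2 fun n p hp => ?_
  -- A plot must have a standard Euclidean space as its domain, so the product with the time axis is
  -- identified with one.
  let e := toEuclidean (E := EuclideanSpace ℝ (Fin n) × ℝ)
  have h1 : IsPlot fun w => g (p (e.symm w).1, (e.symm w).2) := by
    refine hg _ _ (isPlot_prod_iff.2 ⟨?_, ?_⟩)
    · exact isPlot_reparam hp (contDiff_fst.comp e.symm.contDiff)
    · exact (contDiff_snd.comp e.symm.contDiff).isPlot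
  have h2 : Continuous fun w : EuclideanSpace ℝ (Fin n) × ℝ => g (p w.1, w.2) := by
    have := h1.contDiff.continuous.comp e.continuous
    simpa [Function.comp_def] using this
  have h3 : IsOpen {w : EuclideanSpace ℝ (Fin n) × ℝ | g (p w.1, w.2) ≠ 0} :=
    isOpen_ne_fun h2 continuous_const
  refine isOpen_iff_mem_nhds.2 fun y hy => ?_
  -- This is the tube lemma along the compact set `K`.
  exact hK.eventually_forall_of_forall_eventually fun s hs => h3.mem_nhds (hy s hs)

variable [DiffeologicalGroup G]

/-- Beyond time `b` the lift is continued by the section `BG.sec i`, moved by an element of `G` read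
off from `σ`. The two lifts agree on a time interval of positive length, so they glue smoothly. -/
theorem IsLift.exists_extension {H : X × ℝ → BG G} (hH : DSmooth H) {V : Set X} {b : ℝ}
    {σ : X → ℝ → EG G} (hσ : IsLift H V b σ) (hV : IsOpen[dTopology] V) {x : X} (hx : x ∈ V)
    {ε : ℝ} (hε : 0 < ε) {i : ℕ}
    (hi : ∀ s ∈ Set.Icc (b - 2 * ε) (b + 2 * ε), BG.weight i (H (x, s)) ≠ 0) :
    ∃ V', IsOpen[dTopology] V' ∧ x ∈ V' ∧ ∃ σ', IsLift H V' (b + ε) σ' := by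
  classical
  -- `κ` stays in `[b - 2ε, b]`, where `σ` lifts `H`, and `μ` stays in `[b - 2ε, b + 2ε]`, where the
  -- weight is nonzero. Both are the identity on `[b - 3ε/2, b - ε/2]`, and `μ` is so up to `b +
  -- 3ε/2`.
  obtain ⟨κ, hκ, hκR, hκr⟩ := exists_smooth_clamp (b - ε) (half_pos hε) (half_lt_self hε)
  obtain ⟨μ, hμ, hμR, hμr⟩ := exists_smooth_clamp b (r := 3 / 2 * ε) (R := 2 * ε)
    (by positivity) (by linarith)
  let V₁ : Set X := {x | ∀ s ∈ Set.Icc (b - 2 * ε) (b + 2 * ε), BG.weight i (H (x, s)) ≠ 0}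
  have hV₁ : IsOpen[dTopology] V₁ :=
    isOpen_setOf_forall_ne_zero ((BG.dsmooth_weight i).comp hH) isCompact_Icc
  let τ : X → ℝ → EG G := fun y s => (EG.coord i (σ y (κ s)))⁻¹ • BG.sec i (H (y, μ s))
  have hκb : ∀ s, b - 2 * ε ≤ κ s ∧ κ s ≤ b := fun s => by
    have := abs_lt.1 (hκR s)
    constructor <;> linarith
  have hσw : ∀ y ∈ V ∩ V₁, ∀ s, EG.weight i (σ y (κ s)) ≠ 0 := fun y hy s => by
    rw [← BG.weight_proj, hσ.proj y hy.1 _ (hκb s).2]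
    exact hy.2 _ ⟨(hκb s).1, by linarith [(hκb s).2]⟩
  have hμw : ∀ y ∈ V ∩ V₁, ∀ s, BG.weight i (H (y, μ s)) ≠ 0 := fun y hy s => by
    have := abs_lt.1 (hμR s)
    exact hy.2 _ ⟨by linarith, by linarith⟩
  have hτσ : ∀ y ∈ V ∩ V₁, ∀ s, b - 3 / 2 * ε ≤ s → s ≤ b - ε / 2 → τ y s = σ y s :=
    fun y hy s h1 h2 => by
      have hκs : κ s = s := hκr s (abs_le.2 ⟨by linarith, by linarith⟩)
      have hμs : μ s = s := hμr s (abs_le.2 ⟨by linarith, by linarith⟩)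
      have hw := hσw y hy s
      rw [hκs] at hw
      simp only [τ]
      rw [hκs, hμs, ← hσ.proj y hy.1 s (by linarith), BG.sec_proj hw, inv_smul_smul]
  -- The switch at `b - ε` is in the middle of the interval where `σ` and `τ` agree.
  refine ⟨V ∩ V₁, @IsOpen.inter _ dTopology _ _ hV hV₁, ⟨hx, hi⟩,
    fun y s => if s < b - ε then σ y s else τ y s, fun n y s hy hs hyV => ?_, fun y hy s hs => ?_⟩
  · let U : Bool → Set ℝ := fun c => bif c then Set.Iio (b - ε / 2) else Set.Ioi (b - 3 / 2 * ε)
    refine isPlot_of_cover hs U (fun c => ?_) (fun w => ?_) fun c m f hf hc => ?_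
    · cases c
      · exact (isOpen_Ioi : IsOpen (Set.Ioi (b - 3 / 2 * ε)))
      · exact (isOpen_Iio : IsOpen (Set.Iio (b - ε / 2)))
    · by_cases hw : s w < b - ε / 2
      · exact ⟨true, hw⟩
      · exact ⟨false, show b - 3 / 2 * ε < s w by linarith⟩
    · have hyf : IsPlot fun w => y (f w) := isPlot_reparam hy hf
      have hsf : IsPlot fun w => s (f w) := isPlot_reparam hs hf
      cases c
      · have hc' : ∀ w, b - 3 / 2 * ε < s (f w) := hc
        have : (fun w => if s (f w) < b - ε then σ (y (f w)) (s (f w)) else τ (y (f w)) (s (f w))) =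
            fun w => τ (y (f w)) (s (f w)) := funext fun w => by
          split_ifs with h
          · exact (hτσ _ (hyV _) _ (hc' w).le (by linarith)).symm
          · rfl
        rw [this]
        refine isPlot_smul (isPlot_inv (EG.isPlot_coord (hσ.isPlot m _ _ hyf
          (isPlot_real_of_contDiff hκ hsf) fun w => (hyV _).1) fun w => hσw _ (hyV _) _))
          (BG.isPlot_sec (hH _ _ (isPlot_prod_iff.2 ⟨hyf, isPlot_real_of_contDiff hμ hsf⟩))
            fun w => hμw _ (hyV _) _)
      · have hc' : ∀ w, s (f w) < b - ε / 2 := hc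
        have : (fun w => if s (f w) < b - ε then σ (y (f w)) (s (f w)) else τ (y (f w)) (s (f w))) =
            fun w => σ (y (f w)) (s (f w)) := funext fun w => by
          split_ifs with h
          · rfl
          · exact hτσ _ (hyV _) _ (by linarith) (hc' w).le
        rw [this]
        exact hσ.isPlot m _ _ hyf hsf fun w => (hyV _).1
  · split_ifs with h
    · exact hσ.proj y hy.1 s (by linarith)
    · have hμs : μ s = s := hμr s (abs_le.2 ⟨by linarith, by linarith⟩)
      rw [EG.proj_smul, BG.proj_sec, hμs]

/-- By `h0`, a section over `H (·, 0)` is a lift for all times `s ≤ 0`. Compactness of `[0, 1]` at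
the given `x` bounds the number of extensions, so the neighbourhood shrinks only finitely often. -/
theorem exists_isLift {H : X × ℝ → BG G} (hH : DSmooth H)
    (h0 : ∀ x, ∀ s ≤ 0, H (x, s) = H (x, 0)) (x : X) :
    ∃ V, IsOpen[dTopology] V ∧ x ∈ V ∧ ∃ σ, IsLift H V 1 σ := by
  have hc : ∀ (x : X), DSmooth fun s : ℝ => (x, s) := fun x => dsmooth_prod dSmooth_const dSmooth_id
  obtain ⟨δ, hδ, hball⟩ := lebesgue_number_lemma_of_metric (s := Set.Icc (0 : ℝ) 1)
    (c := fun i : ℕ => {s : ℝ | BG.weight i (H (x, s)) ≠ 0}) isCompact_Icc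
    (fun i => isOpen_setOf_ne_zero ((BG.dsmooth_weight i).comp (hH.comp (hc x))))
    fun s _ => Set.mem_iUnion.2 (BG.exists_weight_ne_zero (H (x, s)))
  have key : ∀ N : ℕ, ∃ V, IsOpen[dTopology] V ∧ x ∈ V ∧
      ∃ σ, IsLift H V (min 1 (N * (δ / 3))) σ := fun N => by
    induction N with
    | zero =>
      obtain ⟨i, hi⟩ := BG.exists_weight_ne_zero (H (x, 0))
      have hH0 : DSmooth fun x => H (x, 0) := hH.comp (dsmooth_prod dSmooth_id dSmooth_const)
      refine ⟨{x | BG.weight i (H (x, 0)) ≠ 0},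
        isOpen_setOf_ne_zero ((BG.dsmooth_weight i).comp hH0), hi,
        fun y _ => BG.sec i (H (y, 0)), fun n y s hy _ hyV => ?_, fun y hy s hs => ?_⟩
      · exact BG.isPlot_sec (hH0 _ _ hy) hyV
      · rw [BG.proj_sec, h0 y s (by simpa using hs)]
    | succ N ih =>
      obtain ⟨V, hV, hxV, σ, hσ⟩ := ih
      have hb : min 1 (N * (δ / 3)) ∈ Set.Icc (0 : ℝ) 1 :=
        ⟨le_min zero_le_one (by positivity), min_le_left _ _⟩
      obtain ⟨i, hi⟩ := hball _ hb
      -- The extension needs one weight to be nonzero within `2 * ε` of the current time; `ε = δ /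
      -- 3` keeps this inside a ball of the Lebesgue radius `δ`.
      obtain ⟨V', hV', hxV', σ', hσ'⟩ := hσ.exists_extension hH hV hxV (ε := δ / 3) (by positivity)
        (i := i) fun s hs => hi (by
          rw [Metric.mem_ball, Real.dist_eq, abs_lt]
          constructor <;> linarith [hs.1, hs.2])
      refine ⟨V', hV', hxV', σ', hσ'.isPlot, fun y hy s hs => hσ'.proj y hy s (hs.trans ?_)⟩
      rw [min_add]
      refine le_min ((min_le_left _ _).trans (by linarith)) ((min_le_right _ _).trans ?_)
      push_cast
      linarith
  obtain ⟨N, hN⟩ := exists_nat_ge (3 / δ)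
  obtain ⟨V, hV, hxV, σ, hσ⟩ := key N
  refine ⟨V, hV, hxV, σ, ?_⟩
  rwa [min_eq_left] at hσ
  rw [div_le_iff₀ hδ] at hN
  linarith

end Lifts

/-! ### Homotopy invariance -/

theorem sum_range_eq_one {ζ : ℕ → ℝ} (h1 : ∑ᶠ k, ζ k = 1) {S : Finset ℕ}
    (hS : ∀ k ∉ S, ζ k = 0) {N : ℕ} (hN : ∀ k ∈ S, k < N) : ∑ k ∈ Finset.range N, ζ k = 1 := by
  rw [← h1]
  refine (finsum_eq_sum_of_support_subset ζ fun k hk => ?_).symm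
  have hkS : k ∈ S := by
    by_contra h
    exact hk (hS k h)
  exact_mod_cast Finset.mem_range.2 (hN k hkS)

theorem exists_isTransport {G : Type u} [Group G] [DiffeologicalSpace G] [DiffeologicalGroup G]
    (X : DiffeolHSP.{u}) {f₀ f₁ : X.carrier → BG G} {hf₀ : DSmooth f₀}
    {hf₁ : DSmooth f₁} (h : SmoothlyHomotopic ⟨f₀, hf₀⟩ ⟨f₁, hf₁⟩) :
    ∃ Φ, IsTransport f₀ f₁ Φ := by
  cases isEmpty_or_nonempty X.carrier
  · exact ⟨fun _ z => z, fun x => isEmptyElim x, fun x => isEmptyElim x,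
      fun _ x => isEmptyElim (x 0)⟩
  obtain ⟨H', hH', h0, h1⟩ := h
  -- The reparametrisation makes the homotopy constant for negative times, where the local lifts
  -- start.
  let H : X.carrier × ℝ → BG G := fun q => H' (q.1, Real.smoothTransition q.2)
  have hH : DSmooth H := hH'.comp (dsmooth_prod dsmooth_fst
    (Real.smoothTransition.contDiff.dSmooth.comp dsmooth_snd))
  have hH0 : ∀ x, H (x, 0) = f₀ x := fun x => by simp [H, h0]
  have hH1 : ∀ x, H (x, 1) = f₁ x := fun x => by simp [H, h1]
  choose V hV hxV σ hσ using exists_isLift hH fun x s hs => by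
    simp [H, Real.smoothTransition.zero_of_nonpos hs]
  obtain ⟨r, ζ, hζ, hζ0, hζ1, hloc⟩ := X.exists_countable_partition V hV
    (Set.iUnion_eq_univ_iff.2 fun x => ⟨x, hxV x⟩)
  let ψ : ℕ → X.carrier → ℝ := fun N x => ∑ k ∈ Finset.range N, ζ k x
  have hψ : ∀ N, DSmooth (ψ N) := fun N n p hp =>
    (ContDiff.sum fun k _ => (hζ k n p hp).contDiff).isPlot
  have hev : ∀ x, ∃ W, IsOpen[dTopology] W ∧ x ∈ W ∧ ∃ N, ∀ k ≥ N, ∀ y ∈ W, ψ k y = 1 :=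
    fun x => by
      obtain ⟨W, hW, hxW, S, hS, _⟩ := hloc x
      refine ⟨W, hW, hxW, S.sup id + 1, fun k hk y hy =>
        sum_range_eq_one (hζ1 y) (fun j hj => hS j hj y hy) fun j hj => ?_⟩
      exact (Nat.lt_succ_of_le (Finset.le_sup (f := id) hj)).trans_le hk
  -- The local lifts are valid only up to time `1`.
  have hψ1 : ∀ N x, ψ N x ≤ 1 := fun N x => by
    obtain ⟨W, _, hxW, M, hM⟩ := hev x
    rw [← hM _ (le_max_right N M) x hxW]
    exact Finset.sum_le_sum_of_subset_of_nonneg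
      (Finset.range_mono (le_max_left _ _)) fun k _ _ => hζ0 k x
  classical
  -- Outside `V (r N)` the function `ζ N` vanishes locally, because a nearby closed support would
  -- force `x ∈ V (r N)`.
  have hstep : ∀ N, ∀ x ∉ V (r N), ∃ W, IsOpen[dTopology] W ∧ x ∈ W ∧
      ∀ y ∈ W, ψ N y = ψ (N + 1) y := fun N x hx => by
    obtain ⟨W, hW, hxW, S, hS, hS'⟩ := hloc x
    refine ⟨W, hW, hxW, fun y hy => ?_⟩
    have hN : N ∉ S := fun h => hx (hS' N h hxW)
    simp [ψ, Finset.sum_range_succ, hS N hN y hy]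
  -- The composite starts at `f₀` because the empty sum `ψ 0` is zero. Near each point `ψ k` is
  -- eventually `1`, so the intermediate maps equal `f₁` and the steps are identities.
  have := IsTransport.exists_limit (b := f₁) (fun N => (hσ (r N)).isTransport (hV _) (hψ N)
    (hψ (N + 1)) (hψ1 _) (hψ1 _) (hstep N)) fun x => by
      obtain ⟨W, hW, hxW, N, hN⟩ := hev x
      refine ⟨W, hW, hxW, N, fun k hk y hy => ⟨?_, fun z => if_pos ?_⟩⟩
      · rw [hN k hk y hy, hH1]
      · rw [hN k hk y hy, hN (k + 1) (hk.trans (Nat.le_succ k)) y hy]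
  simpa [ψ, hH0] using this

/-! ### Associated bundles of homotopic maps -/

namespace AssociatedBundle

variable {G : Type u} [Group G] [DiffeologicalSpace G] [DiffeologicalGroup G]
  {F : Type u} [DiffeologicalSpace F] [MulAction G F] [DiffeologicalAction G F]

/-- `Φ` takes the local sections over `f₀` to points over `f₁`, and their differences from the local
sections there form a comparison. Invertibility of `Φ` is not needed, since comparisons are
invertible. -/
theorem bundleIso_of_isTransport {X : Type u} [DiffeologicalSpace X] [Nonempty F]
    {f₀ f₁ : X → BG G} (hf₀ : DSmooth f₀) (hf₁ : DSmooth f₁) {Φ : X → EG G → EG G}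
    (hΦ : IsTransport f₀ f₁ Φ) : BundleIso (bundle F hf₀).proj (bundle F hf₁).proj := by
  have hp : ∀ i x, EG.proj G (Φ x (BG.sec i (f₀ x))) = f₁ x := fun i x =>
    hΦ.proj x _ (BG.proj_sec _ _)
  have hp' : ∀ i j x, EG.proj G (BG.sec j (f₁ x)) = EG.proj G (Φ x (BG.sec i (f₀ x))) :=
    fun i j x => (BG.proj_sec _ _).trans (hp i x).symm
  let c : GAtlas.Comparison (atlas F hf₀) (atlas F hf₁) :=
    { toFun := fun i j x => EG.diff (BG.sec j.down (f₁ x)) (Φ x (BG.sec i.down (f₀ x)))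
      isPlot_toFun := fun i j n x hx hi hj => EG.isPlot_diff (BG.isPlot_sec (hf₁ n _ hx) hj)
        (hΦ.isPlot n _ _ hx (BG.isPlot_sec (hf₀ n _ hx) hi) fun _ => BG.proj_sec _ _)
        fun _ => hp' _ _ _
      trans_mul := fun i i' j x hi hi' hj => by
        rw [BG.sec_eq_smul i'.down hi, hΦ.smul x _ _ (BG.proj_sec _ _),
          EG.diff_smul_right _ (hp' _ _ _)]
        rfl
      mul_trans := fun i j j' x hi hj hj' => by
        refine (EG.diff_eq ?_).symm
        rw [mul_smul]
        change _ • EG.coord j.down (BG.sec j'.down (f₁ x)) • BG.sec j'.down (f₁ x) = _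
        rw [← BG.sec_eq_smul j'.down hj, EG.diff_smul (hp' _ _ _)] }
  exact c.bundleIso dsmooth_proj dsmooth_proj

end AssociatedBundle

/-! ### Classifying maps -/

namespace GAtlas

variable {G F : Type u} [Group G] [DiffeologicalSpace G] [DiffeologicalSpace F] [MulAction G F]
  {X E : Type u} [DiffeologicalSpace X] [DiffeologicalSpace E] {π : E → X}

/-- The lift to `EG` of the classifying map of a bundle, over the `j`-th set of the atlas. -/
def classifyingLift (A : GAtlas G F π) (r : ℕ → A.ι) {ζ : ℕ → X → ℝ}
    (h0 : ∀ k x, 0 ≤ ζ k x) (hfin : ∀ x, (Function.support fun k => ζ k x).Finite)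
    (h1 : ∀ x, ∑ᶠ k, ζ k x = 1) (j : A.ι) (x : X) : EG G :=
  EG.mk (fun k => ζ k x) (fun k => h0 k x) (hfin x) (h1 x) fun k => A.trans (r k) j x

section

variable (A : GAtlas G F π) {r : ℕ → A.ι} {ζ : ℕ → X → ℝ}
  {h0 : ∀ k x, 0 ≤ ζ k x} {hfin : ∀ x, (Function.support fun k => ζ k x).Finite}
  {h1 : ∀ x, ∑ᶠ k, ζ k x = 1}

/-- By the cocycle condition, passing from `j` to `j'` multiplies every relevant coordinate on the
right by `A.trans j j' x`, which is the action of `A.trans j' j x`. -/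
theorem proj_classifyingLift (hU : ∀ k x, ζ k x ≠ 0 → x ∈ A.U (r k)) {j j' : A.ι} {x : X}
    (hj : x ∈ A.U j) (hj' : x ∈ A.U j') :
    EG.proj G (A.classifyingLift r h0 hfin h1 j x) =
      EG.proj G (A.classifyingLift r h0 hfin h1 j' x) := by
  have : A.trans j' j x • A.classifyingLift r h0 hfin h1 j x =
      A.classifyingLift r h0 hfin h1 j' x := by
    refine EG.ext_weight_coord (fun k => EG.weight_smul _ _ _) fun k hk => ?_
    rw [EG.weight_smul] at hk
    have hk' : ζ k x ≠ 0 := hk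
    rw [EG.coord_smul _ hk, classifyingLift, EG.coord_mk _ _ _ _ _ hk', classifyingLift,
      EG.coord_mk _ _ _ _ _ hk', A.inv_trans hj' hj, A.cocycle _ _ _ _ ⟨⟨hU k x hk', hj⟩, hj'⟩]
  rw [← this, EG.proj_smul]

/-- `A.trans (r k) j` is smooth only over `U (r k) ∩ U j`. On `W` the weights with `k ∉ S` vanish,
so those coordinates may be replaced by `1`, while for `k ∈ S` the set `W` lies in `U (r k)`. -/
theorem isPlot_classifyingLift (hζ : ∀ k, DSmooth (ζ k))
    (hloc : ∀ x, ∃ W, IsOpen[dTopology] W ∧ x ∈ W ∧ ∃ S : Finset ℕ,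
      (∀ k ∉ S, ∀ y ∈ W, ζ k y = 0) ∧ ∀ k ∈ S, W ⊆ A.U (r k)) (j : A.ι) {n : ℕ}
    {p : EuclideanSpace ℝ (Fin n) → X} (hp : IsPlot p) (hj : ∀ y, p y ∈ A.U j) :
    IsPlot fun y => A.classifyingLift r h0 hfin h1 j (p y) := by
  classical
  choose W hW hxW S hS hS' using hloc
  refine isPlot_of_cover hp W hW (fun y => ⟨_, hxW _⟩) fun x m f hf hy => ?_
  have hpf : IsPlot fun y => p (f y) := isPlot_reparam hp hf
  have : (fun y => A.classifyingLift r h0 hfin h1 j (p (f y))) = fun y =>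
      EG.mk (fun k => ζ k (p (f y))) (fun k => h0 k _) (hfin _) (h1 _)
        fun k => if k ∈ S x then A.trans (r k) j (p (f y)) else 1 := funext fun y => by
    refine EG.ext_weight_coord (fun k => rfl) fun k hk => ?_
    have hk' : ζ k (p (f y)) ≠ 0 := hk
    have hkS : k ∈ S x := by
      by_contra h
      exact hk' (hS x k h _ (hy y))
    rw [classifyingLift, EG.coord_mk _ _ _ _ _ hk', EG.coord_mk _ _ _ _ _ hk', if_pos hkS]
  rw [this]
  refine EG.isPlot_mk (fun k => hζ k _ _ hpf) fun k => ?_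
  by_cases hk : k ∈ S x
  · simp only [hk, if_true]
    exact A.isPlot_trans _ _ hpf fun y => ⟨hS' x k hk (hy y), hj _⟩
  · simp only [hk, if_false]
    exact isPlot_const

end

end GAtlas

/-! ### Surjectivity and the natural transformation -/

namespace AssociatedBundle

variable {G : Type u} [Group G] [DiffeologicalSpace G] [DiffeologicalGroup G]
  {F : Type u} [DiffeologicalSpace F] [MulAction G F] [DiffeologicalAction G F] [Nonempty F]

/-- Every bundle over a Hausdorff, second-countable, smoothly paracompact space is associated to
a pullback of `EG`. -/
theorem exists_bundleIso (X : DiffeolHSP.{u}) (B : FibreBundle G F X.carrier) :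
    ∃ (f : X.carrier → BG G) (hf : DSmooth f), BundleIso (bundle F hf).proj B.proj := by
  obtain ⟨A⟩ := B.locallyTrivial
  cases isEmpty_or_nonempty X.carrier
  · have hf : DSmooth (isEmptyElim : X.carrier → BG G) := fun _ p => isEmptyElim (p 0)
    let c : GAtlas.Comparison (atlas F hf) A :=
      { toFun := fun _ _ _ => 1
        isPlot_toFun := fun _ _ _ p => isEmptyElim (p 0)
        trans_mul := fun _ _ _ x => isEmptyElim x
        mul_trans := fun _ _ _ x => isEmptyElim x }
    exact ⟨_, hf, c.bundleIso dsmooth_proj B.dsmooth_proj⟩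
  obtain ⟨f, hf, r, hU, htrans⟩ : ∃ (f : X.carrier → BG G) (_ : DSmooth f) (r : ℕ → A.ι),
      (∀ k x, BG.weight k (f x) ≠ 0 → x ∈ A.U (r k)) ∧
      ∀ k l x, BG.weight k (f x) ≠ 0 → BG.weight l (f x) ≠ 0 →
        trans k l (f x) = A.trans (r k) (r l) x := by
    obtain ⟨r, ζ, hζ, h0, h1, hloc⟩ := X.exists_countable_partition A.U A.isOpen A.cover
    have hU : ∀ k x, ζ k x ≠ 0 → x ∈ A.U (r k) := fun k x hk => by
      obtain ⟨W, _, hxW, S, hS, hS'⟩ := hloc x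
      by_cases hkS : k ∈ S
      · exact hS' k hkS hxW
      · exact absurd (hS k hkS x hxW) hk
    have hfin : ∀ x, (Function.support fun k => ζ k x).Finite := fun x => by
      obtain ⟨W, _, hxW, S, hS, _⟩ := hloc x
      refine S.finite_toSet.subset fun k hk => ?_
      by_contra hkS
      exact hk (hS k hkS x hxW)
    choose j hj using A.exists_mem
    -- The chart `j x` is chosen pointwise with no regularity; in `BG` the choice does not matter,
    -- so locally a fixed chart `i` takes its place.
    let f : X.carrier → BG G := fun x => EG.proj G (A.classifyingLift r h0 hfin h1 (j x) x)
    refine ⟨f, fun n p hp => ?_, r, hU, fun k l x hk hl => ?_⟩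
    · refine isPlot_of_cover hp A.U A.isOpen (fun y => A.exists_mem _) fun i m s hs hi => ?_
      have : (fun y => (f ∘ p) (s y)) = fun y =>
          EG.proj G (A.classifyingLift r h0 hfin h1 i (p (s y))) := funext fun y =>
        A.proj_classifyingLift hU (hj _) (hi y)
      rw [this]
      exact EG.isPlot_proj (A.isPlot_classifyingLift hζ hloc i (isPlot_reparam hp hs) hi)
    · have hk' : ζ k x ≠ 0 := hk
      have hl' : ζ l x ≠ 0 := hl
      change trans k l (EG.proj G (A.classifyingLift r h0 hfin h1 (j x) x)) = _
      rw [trans_proj (z := A.classifyingLift r h0 hfin h1 (j x) x) hk hl,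
        GAtlas.classifyingLift, EG.coord_mk _ _ _ _ _ hk', EG.coord_mk _ _ _ _ _ hl',
        A.inv_trans (hU l x hl') (hj x),
        A.cocycle _ _ _ _ ⟨⟨hU k x hk', hj x⟩, hU l x hl'⟩]
  -- The cover by nonvanishing weights refines the atlas through `r`, with matching transition
  -- functions, so the cocycle of `A` itself compares the two.
  let c : GAtlas.Comparison (atlas F hf) A :=
    { toFun := fun k i x => A.trans (r k.down) i x
      isPlot_toFun := fun k i n p hp hk hi =>
        A.isPlot_trans _ _ hp fun y => ⟨hU _ _ (hk y), hi y⟩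
      trans_mul := fun k l i x hk hl hi => by
        change trans k.down l.down (f x) * _ = _
        rw [htrans _ _ x hk hl, A.cocycle _ _ _ _ ⟨⟨hU _ _ hk, hU _ _ hl⟩, hi⟩]
      mul_trans := fun k i i' x hk hi hi' => A.cocycle _ _ _ _ ⟨⟨hU _ _ hk, hi⟩, hi'⟩ }
  exact ⟨f, hf, c.bundleIso dsmooth_proj B.dsmooth_proj⟩

theorem bundleIso_of_smoothlyHomotopic (X : DiffeolHSP.{u})
    {f₀ f₁ : {f : X.carrier → BG G // DSmooth f}} (h : SmoothlyHomotopic f₀ f₁) :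
    BundleIso (bundle F f₀.2).proj (bundle F f₁.2).proj :=
  (exists_isTransport X h).elim fun _ hΦ => bundleIso_of_isTransport f₀.2 f₁.2 hΦ

variable (G F) in
/-- The natural transformation that sends the class of a map to the class of the associated
bundle. -/
def classTransformation :
    homotopyFunctor.{u} (BG G) ⋙ uliftFunctor.{u + 1, u} ⟶ bundleFunctor.{u} G F where
  app X := TypeCat.ofHom fun c => Quot.lift
    (fun f : {f : X.unop.carrier → BG G // DSmooth f} =>
      Quotient.mk (bundleSetoid G F X.unop.carrier) (bundle F f.2))
    (fun _ _ h => Quotient.sound (bundleIso_of_smoothlyHomotopic X.unop h)) c.down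
  naturality X Y φ := by
    ext ⟨c⟩
    induction c using Quot.ind with | mk f =>
    exact Quotient.sound (bundleIso_pullback f.2 φ.unop.2)

end AssociatedBundle

end

end MilnorDiffeology

theorem corollaryc (G : Type u) [Group G] [DiffeologicalSpace G] [DiffeologicalGroup G]
    (F : Type u) [DiffeologicalSpace F] [Nonempty F] [MulAction G F] [DiffeologicalAction G F] :
    ∃ η : homotopyFunctor.{u} (BG G) ⋙ uliftFunctor.{u + 1, u} ⟶ bundleFunctor.{u} G F,
      (∀ X : DiffeolHSP.{u}ᵒᵖ, Function.Surjective (η.app X)) ∧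
      ∀ (X : DiffeolHSP.{u}) (f : X.carrier → BG G) (hf : Diffeology.DSmooth f),
        ∃ A : FibreBundle G F X.carrier,
          η.app (Opposite.op X) (ULift.up (HomotopyClasses.mk f hf)) =
            Quotient.mk (bundleSetoid G F X.carrier) A ∧
          BundleIso A.proj (associatedProj G F f) := by
  refine ⟨AssociatedBundle.classTransformation G F, fun X c => ?_, fun X f hf =>
    ⟨AssociatedBundle.bundle F hf, rfl, (bundleSetoid G F X.carrier).refl _⟩⟩
  induction c using Quotient.inductionOn with | h B =>
  obtain ⟨f, hf, h⟩ := AssociatedBundle.exists_bundleIso X.unop B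
  exact ⟨ULift.up (HomotopyClasses.mk f hf), Quotient.sound h⟩
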